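/- Let $k$ be a field of characteristic zero with a derivation $\partial$, and for a finite dimensional $k$-vector space $V$ let $V^{(1)}=k[\partial]_{\le 1}\otimes_k V$, with the $k$-linear maps $i:V\to V^{(1)}$, $v\mapsto 1\otimes v$, and $\varphi:V^{(1)}\to V$, $1\otimes v\mapsto 0$, $\partial\otimes v\mapsto v$, and the additive map $\partial:V\to V^{(1)}$, $v\mapsto\partial\otimes v$. For $u\in V^*$ let $F(u)\in (V^{(1)})^*$ be given by $F(u)(1\otimes v)=u(v)$, $F(u)(\partial\otimes v)=\partial(u(v))$. Let $(\mathcal C,\omega)$ be a neutral differential Tannakian category over $k$. That is, $\mathcal C$ is a rigid abelian ($k$-linear, symmetric) tensor category with $\mathrm{End}(\underline 1)=k$; $\omega$ is an exact faithful $k$-linear (symmetric) tensor functor from $\mathcal C$ to finite dimensional $k$-vector spaces; and there is a functor $X\mapsto X^{(1)}$ on $\mathcal C$ with a functorial isomorphism $\omega(X^{(1)})\cong\omega(X)^{(1)}$, such that for all objects $X,Y$: (a) there is a short exact sequence $0\to X\xrightarrow{i_X}X^{(1)}\xrightarrow{\phi_X}X\to0$ in $\mathcal C$ with $\omega(i_X)=i$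 and $\omega(\phi_X)=\varphi$; (b) the map $(\omega(X)\otimes\omega(Y))^{(1)}\to\omega(X)^{(1)}\otimes\omega(Y)^{(1)}$ with $1\otimes(v\otimes u)\mapsto(1\otimes v)\otimes(1\otimes u)$ and $\partial\otimes(v\otimes u)\mapsto(\partial\otimes v)\otimes(1\otimes u)+(1\otimes v)\otimes(\partial\otimes u)$ is the image under $\omega$ of a morphism $(X\otimes Y)^{(1)}\to X^{(1)}\otimes Y^{(1)}$; (c) there is a morphism $g_X:(X^*)^{(1)}\to(X^{(1)})^*$ with $g_X\circ i_{X^*}=\phi_X^*$ and $i_X^*\circ g_X=\phi_{X^*}$, such that $\omega(g_X)$ respects the splittings given by some basis $(b_j)$ of $\omega(X)$ with dual basis $(b_j^*)$: each $\omega(g_X)(\partial\otimes b_j^*)$ vanishes on all $\partial\otimes b_l$. For a full subcategory $\mathcal D$ of $\mathcal C$ let $A(\mathcal D)$ be the quotient of $\bigoplus_{V\in\mathcal D}\omega(V)\otimes\omega(V)^*$ by the span of all $v\otimes\omega(f)^*(u)-\omega(f)(v)\otimes u$, where $f:V\to W$ is a morphism in $\mathcal D$, $v\in\omega(V)$, $u\in\omega(W)^*$;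 let $a_V(v\otimes u)$ be the class of $v\otimes u\in\omega(V)\otimes\omega(V)^*$. Let $\{\{X\}\}$ be the smallest full subcategory containing $X$ and closed under finite direct sums, subobjects and quotients, and let $\mathcal C_X$ be the smallest full subcategory containing $X$ and $\underline 1$ and closed under finite direct sums, subobjects, quotients, tensor products, duals and $Y\mapsto Y^{(1)}$. Put $A_X=A(\{\{X\}\})$, $B_X=A(\mathcal C_X)$ and $A=A(\mathcal C)$. Then the following operations are well defined on $A$ and on every $B_X$ (where $\partial$ is additive and satisfies $\partial(ca)=\partial(c)a+c\,\partial(a)$ for $c\in k$), and make each of them a commutative associative differential Hopf algebra over $k$ with unit (multiplication, comultiplication, counit and coinverse all being compatible with $\partial$): $$a_V(v\otimes u)\cdot a_W(w\otimes t)=a_{V\otimes W}((v\otimes w)\otimes(u\otimes t)),\qquad 1=a_{\underline 1}(e\otimes f)\ \text{ with } f(e)=1,$$ $$\partial(a_V(v\otimes u))=a_{V^{(1)}}((\partial\otimes v)\otimes F(u)),\qquad \varepsilon(a_V(v\otimes u))=u(v),$$ $$\Delta(a_V(v\otimes u))=\sum_j a_V(v_j\otimes u)\otimes a_V(v\otimes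 u_j),\qquad S(a_V(v\otimes u))=a_{V^*}(u\otimes v),$$ where $(v_j)$ is any basis of $\omega(V)$ and $(u_j)$ is its dual basis. Each $B_X$ is finitely $\partial$-generated over $k$: there is a finite $G\subset B_X$ such that the elements $\partial^n x$ ($x\in G$, $n\ge0$) generate $B_X$ as a $k$-algebra. The canonical maps $B_X\to B_Y$ for $\mathcal C_X\subseteq\mathcal C_Y$ and $B_X\to A$ are homomorphisms of differential Hopf algebras, and $A=\varinjlim_X B_X$ is the direct limit of the directed system of the $B_X$, $X\in\mathrm{Ob}(\mathcal C)$. Moreover, as vector spaces, $B_X=\varinjlim_{Y\in\mathcal C_X}A_Y$ (directed by inclusion of the categories $\{\{Y\}\}$). -/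

import Mathlib

open CategoryTheory MonoidalCategory
open scoped TensorProduct Differential

universe u u₁ v₁

namespace DiffTannakian

noncomputable section

/-! ### The prolongation functor on finite dimensional vector spaces -/

/-- The prolongation `V⁽¹⁾ = k[∂]_{≤ 1} ⊗ V` of a vector space over a differential field `k`.
The right `k`-module `k[∂]_{≤ 1}` is free on `1, ∂`, so every element is uniquely
`1 ⊗ x + ∂ ⊗ y`; it is stored as the pair `(x, y)`. -/
def Prolong (k : Type*) (V : Type*) [Field k] [Differential k] [AddCommGroup V] [Module k V] :
    Type _ := V × V

namespace Prolong

variable {k : Type*} [Field k] [Differential k]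
variable {V W : Type*} [AddCommGroup V] [Module k V] [AddCommGroup W] [Module k W]

instance : AddCommGroup (Prolong k V) := inferInstanceAs (AddCommGroup (V × V))

/-- Left multiplication by scalars. Since `∂ a = a ∂ + a′` in `k[∂]`, one has
`a (1 ⊗ x + ∂ ⊗ y) = 1 ⊗ (a x - a′ y) + ∂ ⊗ (a y)`. -/
instance : SMul k (Prolong k V) := ⟨fun a z => (a • z.1 - a′ • z.2, a • z.2)⟩

/-- The element `1 ⊗ x + ∂ ⊗ y`. -/
def mk (x y : V) : Prolong k V := (x, y)

theorem mk_fst (x y : V) : (mk (k := k) x y).1 = x := rfl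
theorem mk_snd (x y : V) : (mk (k := k) x y).2 = y := rfl
theorem smul_fst (a : k) (z : Prolong k V) : (a • z).1 = a • z.1 - a′ • z.2 := rfl
theorem smul_snd (a : k) (z : Prolong k V) : (a • z).2 = a • z.2 := rfl
theorem add_fst (z w : Prolong k V) : (z + w).1 = z.1 + w.1 := rfl
theorem add_snd (z w : Prolong k V) : (z + w).2 = z.2 + w.2 := rfl
theorem zero_fst : (0 : Prolong k V).1 = 0 := rfl
theorem zero_snd : (0 : Prolong k V).2 = 0 := rfl

theorem ext' {z w : Prolong k V} (h₁ : z.1 = w.1) (h₂ : z.2 = w.2) : z = w := Prod.ext h₁ h₂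

instance : Module k (Prolong k V) where
  one_smul z := ext' (by simp [smul_fst]) (by simp [smul_snd])
  mul_smul a b z := by
    refine ext' ?_ ?_
    · simp only [smul_fst, smul_snd, Derivation.leibniz, smul_eq_mul]
      module
    · simp only [smul_snd, mul_smul]
  smul_zero a := ext' (by simp [smul_fst, zero_fst, zero_snd]) (by simp [smul_snd, zero_snd])
  smul_add a z w := by
    refine ext' ?_ ?_
    · simp only [smul_fst, add_fst, add_snd]
      module
    · simp only [smul_snd, add_snd, smul_add]
  add_smul a b z := by
    refine ext' ?_ ?_
    · simp only [smul_fst, add_fst, map_add]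
      module
    · simp only [smul_snd, add_snd, add_smul]
  zero_smul z := ext' (by simp [smul_fst, zero_fst]) (by simp [smul_snd, zero_snd])

/-- The inclusion `i : V → V⁽¹⁾`, `v ↦ 1 ⊗ v`. -/
def incl : V →ₗ[k] Prolong k V where
  toFun v := mk v 0
  map_add' v w := ext' rfl (by simp only [add_snd, mk_snd, add_zero])
  map_smul' a v := ext' (by simp [smul_fst, mk_fst, mk_snd]) (by simp [smul_snd, mk_snd])

/-- The derivation `∂ : V → V⁽¹⁾`, `v ↦ ∂ ⊗ v`. -/
def del : V →+ Prolong k V where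
  toFun v := mk 0 v
  map_zero' := rfl
  map_add' v w := ext' (by simp only [add_fst, mk_fst, add_zero]) rfl

/-- The projection `φ : V⁽¹⁾ → V`, `1 ⊗ v ↦ 0`, `∂ ⊗ v ↦ v`. -/
def proj : Prolong k V →ₗ[k] V where
  toFun z := z.2
  map_add' _ _ := rfl
  map_smul' _ _ := rfl

/-- `∂ ⊗ a v = a (∂ ⊗ v) + a′ (1 ⊗ v)`. -/
theorem del_smul (a : k) (v : V) :
    del (k := k) (a • v) = a • del (k := k) v + a′ • incl (k := k) v := by
  refine ext' ?_ ?_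
  · change (0 : V) = (a • (0 : V) - a′ • v) + (a′ • v - (a′)′ • (0 : V))
    simp
  · change a • v = a • v + a′ • (0 : V)
    simp

/-- `V⁽¹⁾` is functorial: `1 ⊗ v ↦ 1 ⊗ f v`, `∂ ⊗ v ↦ ∂ ⊗ f v`. -/
def map (f : V →ₗ[k] W) : Prolong k V →ₗ[k] Prolong k W where
  toFun z := mk (f z.1) (f z.2)
  map_add' z w := ext' (map_add f _ _) (map_add f _ _)
  map_smul' a z := ext' (by simp [smul_fst, mk_fst, mk_snd]) (by simp [smul_snd, mk_snd])

/-- The extension `F(u)` of a functional `u` on `V` to `V⁽¹⁾`: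
`F(u)(1 ⊗ v) = u(v)` and `F(u)(∂ ⊗ v) = ∂(u(v))`. -/
def extendDual (u : Module.Dual k V) : Module.Dual k (Prolong k V) where
  toFun z := u z.1 + Differential.deriv (u z.2)
  map_add' z w := by
    simp only [add_fst, add_snd, map_add]
    ring
  map_smul' a z := by
    simp only [smul_fst, smul_snd, map_sub, map_smul, smul_eq_mul, Derivation.leibniz,
      RingHom.id_apply]
    ring

instance [Module.Finite k V] : Module.Finite k (Prolong k V) := by
  have h : Function.Exact (incl (k := k) (V := V)) proj := by
    intro z
    constructor
    · intro hz
      exact ⟨z.1, ext' rfl (Eq.symm hz)⟩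
    · rintro ⟨v, rfl⟩
      rfl
  have hs : Function.Surjective (proj (k := k) (V := V)) := fun v => ⟨mk 0 v, rfl⟩
  exact Module.Finite.of_exact h hs

end Prolong

/-- The prolongation functor `V ↦ V⁽¹⁾` on finite dimensional vector spaces. -/
def prolongFunctor (k : Type u) [Field k] [Differential k] :
    FGModuleCat.{u} k ⥤ FGModuleCat.{u} k where
  obj V := FGModuleCat.of k (Prolong k V)
  map f := FGModuleCat.ofHom (Prolong.map f.hom.hom)
  map_id _ := rfl
  map_comp _ _ := rfl

/-! ### Neutral differential Tannakian categories -/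

section

variable (k : Type u) [Field k] [Differential k]
variable (C : Type u₁) [Category.{v₁} C] [Abelian C] [MonoidalCategory C]
  [SymmetricCategory C] [RigidCategory C] [Linear k C]

/-- An exact faithful `k`-linear (symmetric) tensor functor `ω` to finite dimensional vector
spaces, an endofunctor `F : X ↦ X⁽¹⁾` of `C`, and a functorial isomorphism
`ω(X⁽¹⁾) ≅ ω(X)⁽¹⁾`. -/
structure FiberData where
  /-- the fiber functor -/
  ω : C ⥤ FGModuleCat.{u} k
  [braided : ω.Braided]
  [additive : ω.Additive]
  [linear : ω.Linear k]
  [faithful : ω.Faithful]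
  [preservesFiniteLimits : Limits.PreservesFiniteLimits ω]
  [preservesFiniteColimits : Limits.PreservesFiniteColimits ω]
  /-- the prolongation functor of `C` -/
  F : C ⥤ C
  /-- `F` intertwines with `ω` -/
  comparison : F ⋙ ω ≅ ω ⋙ prolongFunctor k

attribute [instance] FiberData.braided FiberData.additive FiberData.linear FiberData.faithful
  FiberData.preservesFiniteLimits FiberData.preservesFiniteColimits

end

section

variable {k : Type u} [Field k] [Differential k]
variable {C : Type u₁} [Category.{v₁} C] [Abelian C] [MonoidalCategory C]
  [SymmetricCategory C] [RigidCategory C] [Linear k C]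

namespace FiberData

variable (T : FiberData k C)

/-- The linear map `ω(f)`. -/
def ωmap {X Y : C} (f : X ⟶ Y) : T.ω.obj X →ₗ[k] T.ω.obj Y := (T.ω.map f).hom.hom

/-- The identification `ω(X⁽¹⁾) ≅ ω(X)⁽¹⁾`. -/
def prolongEquiv (X : C) : T.ω.obj (T.F.obj X) ≃ₗ[k] Prolong k (T.ω.obj X) :=
  FGModuleCat.isoToLinearEquiv (T.comparison.app X)

/-- The element `1 ⊗ v` of `ω(X⁽¹⁾)`. -/
def oneElt (X : C) (v : T.ω.obj X) : T.ω.obj (T.F.obj X) :=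
  (T.prolongEquiv X).symm (Prolong.incl v)

/-- The element `∂ ⊗ v` of `ω(X⁽¹⁾)`. -/
def delElt (X : C) (v : T.ω.obj X) : T.ω.obj (T.F.obj X) :=
  (T.prolongEquiv X).symm (Prolong.del v)

/-- The functional `F(u)` on `ω(X⁽¹⁾)`. -/
def extendDual (X : C) (u : Module.Dual k (T.ω.obj X)) : Module.Dual k (T.ω.obj (T.F.obj X)) :=
  Prolong.extendDual u ∘ₗ (T.prolongEquiv X).toLinearMap

/-- The identification `ω(X) ⊗ ω(Y) → ω(X ⊗ Y)`. -/
def tensorTo (X Y : C) : T.ω.obj X ⊗[k] T.ω.obj Y →ₗ[k] T.ω.obj (X ⊗ Y) :=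
  (Functor.LaxMonoidal.μ T.ω X Y).hom.hom

/-- The inverse identification `ω(X ⊗ Y) → ω(X) ⊗ ω(Y)`. -/
def tensorFrom (X Y : C) : T.ω.obj (X ⊗ Y) →ₗ[k] T.ω.obj X ⊗[k] T.ω.obj Y :=
  (Functor.OplaxMonoidal.δ T.ω X Y).hom.hom

/-- The identification `k → ω(1)`. -/
def unitTo : k →ₗ[k] T.ω.obj (𝟙_ C) := (Functor.LaxMonoidal.ε T.ω).hom.hom

/-- The inverse identification `ω(1) → k`. -/
def unitFrom : T.ω.obj (𝟙_ C) →ₗ[k] k := (Functor.OplaxMonoidal.η T.ω).hom.hom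

/-- The functional `u ⊗ t` on `ω(X ⊗ Y) ≅ ω(X) ⊗ ω(Y)`. -/
def dualTensor {X Y : C} (u : Module.Dual k (T.ω.obj X)) (t : Module.Dual k (T.ω.obj Y)) :
    Module.Dual k (T.ω.obj (X ⊗ Y)) :=
  LinearMap.mul' k k ∘ₗ TensorProduct.map u t ∘ₗ T.tensorFrom X Y

/-- The identification `ω(X^*) → ω(X)^*`, given by the evaluation
`ω(X^*) ⊗ ω(X) ≅ ω(X^* ⊗ X) → ω(1) ≅ k`. -/
def toDual (X : C) : T.ω.obj (Xᘁ) →ₗ[k] Module.Dual k (T.ω.obj X) :=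
  TensorProduct.curry
    (T.unitFrom ∘ₗ T.ωmap (ExactPairing.evaluation X (Xᘁ)) ∘ₗ T.tensorTo (Xᘁ) X)

/-- The full abelian subcategory `{{X}}` of `C` generated by `X`. -/
inductive abGen (X : C) : ObjectProperty C
  | self : abGen X X
  | biprod {Y Z : C} : abGen X Y → abGen X Z → abGen X (Y ⊞ Z)
  | sub {Y Z : C} (f : Y ⟶ Z) [Mono f] : abGen X Z → abGen X Y
  | quot {Y Z : C} (f : Y ⟶ Z) [Epi f] : abGen X Y → abGen X Z

/-- The full abelian (rigid) tensor subcategory `C_X` of `C` containing `X`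
and closed under `F`. -/
inductive diffGen (X : C) : ObjectProperty C
  | self : diffGen X X
  | unit : diffGen X (𝟙_ C)
  | biprod {Y Z : C} : diffGen X Y → diffGen X Z → diffGen X (Y ⊞ Z)
  | sub {Y Z : C} (f : Y ⟶ Z) [Mono f] : diffGen X Z → diffGen X Y
  | quot {Y Z : C} (f : Y ⟶ Z) [Epi f] : diffGen X Y → diffGen X Z
  | tensor {Y Z : C} : diffGen X Y → diffGen X Z → diffGen X (Y ⊗ Z)
  | dual {Y : C} : diffGen X Y → diffGen X (Yᘁ)
  | prolong {Y : C} : diffGen X Y → diffGen X (T.F.obj Y)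

/-- A class of objects closed under the tensor operations and under `F`. -/
structure IsDiffTensorClosed (P : ObjectProperty C) : Prop where
  unit : P (𝟙_ C)
  tensor {Y Z : C} : P Y → P Z → P (Y ⊗ Z)
  dual {Y : C} : P Y → P (Yᘁ)
  prolong {Y : C} : P Y → P (T.F.obj Y)

theorem isDiffTensorClosed_top : T.IsDiffTensorClosed ⊤ :=
  ⟨trivial, fun _ _ => trivial, fun _ => trivial, fun _ => trivial⟩

theorem isDiffTensorClosed_diffGen (X : C) : T.IsDiffTensorClosed (T.diffGen X) :=
  ⟨.unit, .tensor, .dual, .prolong⟩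

/-- `{{Y}} ⊆ C_X` for every object `Y` of `C_X`. -/
theorem abGen_le_diffGen {X Y : C} (hY : T.diffGen X Y) : abGen Y ≤ T.diffGen X := by
  intro Z hZ
  induction hZ with
  | self => exact hY
  | biprod _ _ h₁ h₂ => exact .biprod h₁ h₂
  | sub f _ h => exact .sub f h
  | quot f _ h => exact .quot f h

/-! ### The spaces of matrix coefficients -/

open scoped Classical in
/-- The subspace of `⨁_V ω(V) ⊗ ω(V)^*` (over the objects `V` in `P`) spanned by the elements
`v ⊗ ω(f)^*(u) - ω(f)(v) ⊗ u` for `f : V ⟶ W`, `v ∈ ω(V)`, `u ∈ ω(W)^*`. -/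
def coefRel (P : ObjectProperty C) :
    Submodule k (DirectSum {V : C // P V}
      fun V => T.ω.obj V.1 ⊗[k] Module.Dual k (T.ω.obj V.1)) :=
  Submodule.span k {z | ∃ (V W : {V : C // P V}) (f : V.1 ⟶ W.1) (v : T.ω.obj V.1)
    (u : Module.Dual k (T.ω.obj W.1)),
    z = DirectSum.lof k {V : C // P V}
          (fun V => T.ω.obj V.1 ⊗[k] Module.Dual k (T.ω.obj V.1)) V (v ⊗ₜ[k] (u ∘ₗ T.ωmap f))
      - DirectSum.lof k {V : C // P V}
          (fun V => T.ω.obj V.1 ⊗[k] Module.Dual k (T.ω.obj V.1)) W (T.ωmap f v ⊗ₜ[k] u)}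

/-- The vector space `(⨁_V ω(V) ⊗ ω(V)^*) / R` attached to the full subcategory `P` of `C`, that
is, the image under (the extension to ind-objects of) the exact functor `ω` of the quotient of
`⨁_V V ⊗ ω(V)^*` by the minimal subobject that identifies `V ⊗ ω(W)^* → V ⊗ ω(V)^*` with
`V ⊗ ω(W)^* → W ⊗ ω(W)^*` for all morphisms `V ⟶ W` between objects in `P`. -/
def CoefSpace (P : ObjectProperty C) :=
  (DirectSum {V : C // P V} fun V => T.ω.obj V.1 ⊗[k] Module.Dual k (T.ω.obj V.1)) ⧸ T.coefRel P

instance (P : ObjectProperty C) : AddCommGroup (T.CoefSpace P) :=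
  inferInstanceAs (AddCommGroup (_ ⧸ T.coefRel P))

instance (P : ObjectProperty C) : Module k (T.CoefSpace P) :=
  inferInstanceAs (Module k (_ ⧸ T.coefRel P))

open scoped Classical in
/-- The map `a_V : ω(V) ⊗ ω(V)^* → (⨁_V ω(V) ⊗ ω(V)^*) / R`. -/
def coefLin {P : ObjectProperty C} (V : C) (hV : P V) :
    T.ω.obj V ⊗[k] Module.Dual k (T.ω.obj V) →ₗ[k] T.CoefSpace P :=
  (T.coefRel P).mkQ ∘ₗ DirectSum.lof k {V : C // P V}
    (fun V => T.ω.obj V.1 ⊗[k] Module.Dual k (T.ω.obj V.1)) ⟨V, hV⟩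

/-- The element `a_V(v ⊗ u)`. -/
def coef {P : ObjectProperty C} (V : C) (hV : P V) (v : T.ω.obj V)
    (u : Module.Dual k (T.ω.obj V)) : T.CoefSpace P :=
  T.coefLin V hV (v ⊗ₜ[k] u)

/-- `a_V(v ⊗ ω(f)^*(u)) = a_W(ω(f)(v) ⊗ u)`. -/
theorem coef_comp {P : ObjectProperty C} {V W : C} (hV : P V) (hW : P W) (f : V ⟶ W)
    (v : T.ω.obj V) (u : Module.Dual k (T.ω.obj W)) :
    T.coef V hV v (u ∘ₗ T.ωmap f) = T.coef W hW (T.ωmap f v) u := by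
  refine (Submodule.Quotient.eq (T.coefRel P)).2 (Submodule.subset_span ?_)
  exact ⟨⟨V, hV⟩, ⟨W, hW⟩, f, v, u, rfl⟩

open scoped Classical in
/-- For full subcategories `P ⊆ Q`, the canonical map `a_V(v ⊗ u) ↦ a_V(v ⊗ u)`. -/
def coefMap {P Q : ObjectProperty C} (h : P ≤ Q) : T.CoefSpace P →ₗ[k] T.CoefSpace Q :=
  (T.coefRel P).liftQ
    (DirectSum.toModule k {V : C // P V} (T.CoefSpace Q) fun V => T.coefLin V.1 (h V.1 V.2)) (by
      refine Submodule.span_le.2 ?_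
      rintro _ ⟨V, W, f, v, u, rfl⟩
      simp only [SetLike.mem_coe, LinearMap.mem_ker, map_sub, DirectSum.toModule_lof]
      exact sub_eq_zero.2 (T.coef_comp (h V.1 V.2) (h W.1 W.2) f v u))

theorem coefMap_coef {P Q : ObjectProperty C} (h : P ≤ Q) (V : C) (hV : P V) (v : T.ω.obj V)
    (u : Module.Dual k (T.ω.obj V)) :
    T.coefMap h (T.coef V hV v u) = T.coef V (h V hV) v u := by
  classical
  change (DirectSum.toModule k {V : C // P V} (T.CoefSpace Q)
    fun V => T.coefLin V.1 (h V.1 V.2)) (DirectSum.lof k {V : C // P V}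
      (fun V => T.ω.obj V.1 ⊗[k] Module.Dual k (T.ω.obj V.1)) ⟨V, hV⟩ (v ⊗ₜ[k] u)) = _
  rw [DirectSum.toModule_lof]
  rfl

/-- The space `A_X`, attached to the subcategory `{{X}}`. -/
abbrev AX (X : C) := T.CoefSpace (abGen X)

/-- The space `B_X`, attached to the subcategory `C_X`. -/
abbrev BX (X : C) := T.CoefSpace (T.diffGen X)

/-- The space `A`, attached to the whole category `C`. -/
abbrev A := T.CoefSpace (⊤ : ObjectProperty C)

/-- The objects of `C`, preordered by `X ≤ Y` iff `C_X ⊆ C_Y`. -/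
structure DiffIndex (T : FiberData k C) where
  /-- the underlying object -/
  obj : C

instance : Preorder T.DiffIndex := Preorder.lift (fun X => T.diffGen X.obj)

/-- The objects of `C_X`, preordered by `Y ≤ Z` iff `{{Y}} ⊆ {{Z}}`. -/
def AbIndex (X : C) := {Y : C // T.diffGen X Y}

instance (X : C) : Preorder (T.AbIndex X) := Preorder.lift (fun Y => abGen Y.1)

end FiberData

variable (k C) in
/-- A neutral differential Tannakian category over the differential field `k`: a rigid abelian
(symmetric) tensor category `C` with `End(1) = k`, a fiber functor `ω` and a prolongation functor
`F` intertwining with `ω`, subject to the compatibilities below. -/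
structure NeutralDiffTannakian [MonoidalPreadditive C] [MonoidalLinear k C] extends FiberData k C where
  /-- `End(1) = k` -/
  end_unit : Function.Bijective (fun c : k => c • 𝟙 (𝟙_ C))
  /-- the inclusions `i : X → X⁽¹⁾` -/
  i (X : C) : X ⟶ F.obj X
  /-- the surjections `φ : X⁽¹⁾ → X` -/
  φ (X : C) : F.obj X ⟶ X
  i_φ (X : C) : i X ≫ φ X = 0
  /-- `0 → X → X⁽¹⁾ → X → 0` is exact -/
  exact (X : C) : (ShortComplex.mk (i X) (φ X) (i_φ X)).ShortExact
  /-- `ω(i)` is `v ↦ 1 ⊗ v` -/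
  ω_i (X : C) (v : ω.obj X) :
    toFiberData.prolongEquiv X (toFiberData.ωmap (i X) v) = Prolong.incl v
  /-- `ω(φ)` is `1 ⊗ v ↦ 0`, `∂ ⊗ v ↦ v` -/
  ω_φ (X : C) (z : ω.obj (F.obj X)) :
    toFiberData.ωmap (φ X) z = Prolong.proj (toFiberData.prolongEquiv X z)
  /-- The map `(ω(X) ⊗ ω(Y))⁽¹⁾ → ω(X)⁽¹⁾ ⊗ ω(Y)⁽¹⁾` with `1 ⊗ (v ⊗ u) ↦ (1 ⊗ v) ⊗ (1 ⊗ u)` and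
  `∂ ⊗ (v ⊗ u) ↦ (∂ ⊗ v) ⊗ (1 ⊗ u) + (1 ⊗ v) ⊗ (∂ ⊗ u)` comes from a morphism in `C`. -/
  product_rule (X Y : C) : ∃ τ : F.obj (X ⊗ Y) ⟶ F.obj X ⊗ F.obj Y,
    ∀ (v : ω.obj X) (u : ω.obj Y),
      toFiberData.ωmap τ
          (toFiberData.oneElt (X ⊗ Y) (toFiberData.tensorTo X Y (v ⊗ₜ[k] u))) =
        toFiberData.tensorTo (F.obj X) (F.obj Y)
          (toFiberData.oneElt X v ⊗ₜ[k] toFiberData.oneElt Y u) ∧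
      toFiberData.ωmap τ
          (toFiberData.delElt (X ⊗ Y) (toFiberData.tensorTo X Y (v ⊗ₜ[k] u))) =
        toFiberData.tensorTo (F.obj X) (F.obj Y)
          (toFiberData.delElt X v ⊗ₜ[k] toFiberData.oneElt Y u +
            toFiberData.oneElt X v ⊗ₜ[k] toFiberData.delElt Y u)
  /-- There is `g : (X^*)⁽¹⁾ ⟶ (X⁽¹⁾)^*` compatible with `i`, `φ` and their transposes, such that
  `ω(g)` respects the splittings defined by some basis `(b_j)` of `ω(X)`: with `(b'_j)` the dual
  basis, the complement of `1 ⊗ ω(X)^*` spanned by the `∂ ⊗ b'_j` is mapped to the complement of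
  `φ^*(ω(X)^*)` spanned by the `(1 ⊗ b_j)^*`, i.e. to the functionals vanishing on
  all `∂ ⊗ b_j`. (In view of the commutative diagram, this does not depend on the basis.) -/
  dual_rule (X : C) : ∃ g : F.obj (Xᘁ) ⟶ (F.obj X)ᘁ,
    i (Xᘁ) ≫ g = (φ X)ᘁ ∧ g ≫ (i X)ᘁ = φ (Xᘁ) ∧
    ∃ (n : ℕ) (b : Module.Basis (Fin n) k (ω.obj X)) (b' : Fin n → ω.obj (Xᘁ)),
      (∀ j l, toFiberData.toDual X (b' j) (b l) = if j = l then 1 else 0) ∧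
      ∀ j l, toFiberData.toDual (F.obj X)
        (toFiberData.ωmap g (toFiberData.delElt (Xᘁ) (b' j))) (toFiberData.delElt X (b l)) = 0

end

/-! ### Differential Hopf algebras -/

section

variable {k : Type*} [Field k] [Differential k]

/-- The derivation `a ⊗ b ↦ D a ⊗ b + a ⊗ D b` of `M ⊗ M` induced by a derivation `D` of the vector
space `M` that extends the derivation of `k`. -/
def tensorDeriv {M : Type*} [AddCommGroup M] [Module k M] (D : M →+ M)
    (hD : ∀ (c : k) (a : M), D (c • a) = c′ • a + c • D a) : M ⊗[k] M →+ M ⊗[k] M :=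
  TensorProduct.liftAddHom
    (AddMonoidHom.mk' (fun a => AddMonoidHom.mk' (fun b => D a ⊗ₜ[k] b + a ⊗ₜ[k] D b)
      (fun b c => by simp only [map_add, TensorProduct.tmul_add]; abel))
      (fun a b => by
        ext c
        simp only [AddMonoidHom.mk'_apply, AddMonoidHom.add_apply, map_add,
          TensorProduct.add_tmul]
        abel))
    (fun c a b => by
      simp only [AddMonoidHom.mk'_apply, hD, TensorProduct.add_tmul, TensorProduct.tmul_add,
        TensorProduct.smul_tmul]
      abel)

/-- The structure of a commutative associative differential Hopf algebra with unit over the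
differential field `k` on a given vector space `A`: all of multiplication, comultiplication,
counit and coinverse commute with the derivation. -/
structure DiffHopfStructure (k : Type*) [Field k] [Differential k] (A : Type*) [AddCommGroup A]
    [Module k A] extends Coalgebra k A where
  mul : A →ₗ[k] A →ₗ[k] A
  one : A
  mul_assoc (a b c : A) : mul (mul a b) c = mul a (mul b c)
  mul_comm (a b : A) : mul a b = mul b a
  one_mul (a : A) : mul one a = a
  comul_one : comul one = one ⊗ₜ[k] one
  /-- the product of `A ⊗ A` is `(a ⊗ b)(c ⊗ d) = ac ⊗ bd` -/
  comul_mul (a b : A) : comul (mul a b) =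
    TensorProduct.map (TensorProduct.lift mul) (TensorProduct.lift mul)
      (TensorProduct.tensorTensorTensorComm k A A A A (comul a ⊗ₜ[k] comul b))
  counit_one : counit one = 1
  counit_mul (a b : A) : counit (mul a b) = counit a * counit b
  /-- the coinverse -/
  antipode : A →ₗ[k] A
  antipode_one : antipode one = one
  antipode_mul (a b : A) : antipode (mul a b) = mul (antipode a) (antipode b)
  mul_antipode_left (a : A) :
    TensorProduct.lift mul (TensorProduct.map antipode LinearMap.id (comul a)) = counit a • one
  mul_antipode_right (a : A) :
    TensorProduct.lift mul (TensorProduct.map LinearMap.id antipode (comul a)) = counit a • one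
  /-- the derivation `∂` -/
  deriv : A →+ A
  deriv_smul (c : k) (a : A) : deriv (c • a) = c′ • a + c • deriv a
  deriv_mul (a b : A) : deriv (mul a b) = mul (deriv a) b + mul a (deriv b)
  comul_deriv (a : A) : comul (deriv a) = tensorDeriv deriv deriv_smul (comul a)
  counit_deriv (a : A) : counit (deriv a) = Differential.deriv (counit a)
  antipode_deriv (a : A) : antipode (deriv a) = deriv (antipode a)

namespace DiffHopfStructure

variable {A B : Type*} [AddCommGroup A] [Module k A] [AddCommGroup B] [Module k B]

/-- `A` is finitely `∂`-generated: there is a finite set `G` such that the smallest `k`-subalgebra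
containing `∂^n x` for all `x ∈ G` and `n ≥ 0` is `A`. -/
def IsFinDiffGenerated (H : DiffHopfStructure k A) : Prop :=
  ∃ G : Finset A, ∀ N : Submodule k A, H.one ∈ N → (∀ a ∈ N, ∀ b ∈ N, H.mul a b ∈ N) →
    (∀ x ∈ G, ∀ n : ℕ, H.deriv^[n] x ∈ N) → N = ⊤

/-- Homomorphisms of differential Hopf algebras. -/
structure IsHom (H : DiffHopfStructure k A) (K : DiffHopfStructure k B) (f : A →ₗ[k] B) : Prop where
  map_one : f H.one = K.one
  map_mul (a b : A) : f (H.mul a b) = K.mul (f a) (f b)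
  map_comul (a : A) : K.comul (f a) = TensorProduct.map f f (H.comul a)
  map_counit (a : A) : K.counit (f a) = H.counit a
  map_antipode (a : A) : f (H.antipode a) = K.antipode (f a)
  map_deriv (a : A) : f (H.deriv a) = K.deriv (f a)

end DiffHopfStructure

open scoped Classical in
/-- `L`, with the maps `f i : M i → L`, is the direct limit of the directed system of vector spaces
`M` with transition maps `t`. -/
def IsDirectLimit {ι : Type*} [Preorder ι] (M : ι → Type*) [∀ i, AddCommGroup (M i)]
    [∀ i, Module k (M i)] (t : ∀ i j, i ≤ j → M i →ₗ[k] M j)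
    (L : Type*) [AddCommGroup L] [Module k L] (f : ∀ i, M i →ₗ[k] L) : Prop :=
  Nonempty ι ∧ IsDirectedOrder ι ∧ DirectedSystem M (fun i j h => t i j h) ∧
    ∃ h : ∀ i j (hij : i ≤ j) (x : M i), f j (t i j hij x) = f i x,
      Function.Bijective (Module.DirectLimit.lift k ι M t f h)

end

section

variable {k : Type u} [Field k] [Differential k]
variable {C : Type u₁} [Category.{v₁} C] [Abelian C] [MonoidalCategory C]
  [SymmetricCategory C] [RigidCategory C] [Linear k C]

/-- The operations of the differential Hopf algebra structure `H` are given by the formulas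
* `1 = a_1(e ⊗ f)` where `f(e) = 1`,
* `a_V(v ⊗ u) a_W(w ⊗ t) = a_{V ⊗ W}((v ⊗ w) ⊗ (u ⊗ t))`,
* `Δ(a_V(v ⊗ u)) = ∑ a_V(v_j ⊗ u) ⊗ a_V(v ⊗ u_j)` for dual bases `(v_j)`, `(u_j)`,
* `ε(a_V(v ⊗ u)) = u(v)`,
* `S(a_V(v ⊗ u)) = a_{V^*}(u ⊗ v)`, where `u = ⟨ξ, ·⟩` with `ξ ∈ ω(V^*) ≅ ω(V)^*` and `v` is
  regarded as the functional `ξ ↦ ⟨ξ, v⟩` on `ω(V^*)`,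
* `∂(a_V(v ⊗ u)) = a_{V⁽¹⁾}((∂ ⊗ v) ⊗ F(u))`. -/
structure FiberData.HasOperations (T : FiberData k C) {P : ObjectProperty C}
    (hP : T.IsDiffTensorClosed P) (H : DiffHopfStructure k (T.CoefSpace P)) : Prop where
  one : H.one = T.coef (𝟙_ C) hP.unit (T.unitTo 1) T.unitFrom
  mul {V W : C} (hV : P V) (hW : P W) (v : T.ω.obj V) (u : Module.Dual k (T.ω.obj V))
    (w : T.ω.obj W) (t : Module.Dual k (T.ω.obj W)) :
    H.mul (T.coef V hV v u) (T.coef W hW w t) =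
      T.coef (V ⊗ W) (hP.tensor hV hW) (T.tensorTo V W (v ⊗ₜ[k] w)) (T.dualTensor u t)
  comul {V : C} (hV : P V) (v : T.ω.obj V) (u : Module.Dual k (T.ω.obj V))
    (n : ℕ) (b : Module.Basis (Fin n) k (T.ω.obj V)) :
    H.comul (T.coef V hV v u) = ∑ j, T.coef V hV (b j) u ⊗ₜ[k] T.coef V hV v (b.coord j)
  counit {V : C} (hV : P V) (v : T.ω.obj V) (u : Module.Dual k (T.ω.obj V)) :
    H.counit (T.coef V hV v u) = u v
  antipode {V : C} (hV : P V) (v : T.ω.obj V) (ξ : T.ω.obj (Vᘁ)) :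
    H.antipode (T.coef V hV v (T.toDual V ξ)) =
      T.coef (Vᘁ) (hP.dual hV) ξ ((T.toDual V).flip v)
  deriv {V : C} (hV : P V) (v : T.ω.obj V) (u : Module.Dual k (T.ω.obj V)) :
    H.deriv (T.coef V hV v u) =
      T.coef (T.F.obj V) (hP.prolong hV) (T.delElt V v) (T.extendDual V u)

end

end

end DiffTannakian

set_option linter.unusedSectionVars false

namespace DiffTannakian

noncomputable section

/-! ### Differential generation -/

namespace DiffHopfStructure

variable {k A : Type*} [Field k] [Differential k] [AddCommGroup A] [Module k A]
  (H : DiffHopfStructure k A)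

/-! The space of matrix coefficients of a full subcategory is a coend. A linear map out of it is a
family of bilinear maps in `(v, u)` respecting the relation `a_V(v ⊗ ω(f)^*u) = a_W(ω(f)v ⊗ u)`;
this is `coefLift`. Each operation is such a family, and most identities between operations are this
relation applied to one structural morphism.

The braiding, associator and unitor give a commutative, associative, unital product. Evaluation and
coevaluation give the two coinverse axioms. The morphism from the product axiom gives the Leibniz
rule, and the one from the duality axiom makes the coinverse commute with the derivation. The
relation for `i` and `φ` gives the twisted linearity of the derivation.

Comultiplication inserts a resolution of the identity `∑ p_s(z) x_s = z`. By `sum_dual_natural` the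
result is independent of the resolution and compatible with morphisms, so each identity can be
checked in a convenient one: products of bases on `V ⊗ W`, or on `V⁽¹⁾` the vectors `1 ⊗ b_j`, `∂ ⊗
b_j` with functionals `F(b_j^*)`, `φ^*(b_j^*)`.

The derivation is not `k`-linear, so it does not factor through the quotient by linear means alone.
The map `a ↦ (-∂a, a)` into the prolongation of the coefficient space is linear, because `c(x, y) =
(cx - c′y, cy)` there; it is built first and the derivation is read off.

For finite generation, the construction steps of `C_X` show that a subspace containing `1` and the
coefficients of `X`, and closed under product, derivation and coinverse, is all of `B_X`. The
coinverse is an involutive algebra map commuting with the derivation, so adjoining the coinverses of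
the generators makes closure under it automatic. The limit statements hold because each object, and
each morphism between two objects, already lies in some member of the directed family of full
subcategories. -/

theorem deriv_one : H.deriv H.one = 0 := by
  have h := H.deriv_mul H.one H.one
  rw [H.one_mul, H.one_mul, H.mul_comm, H.one_mul] at h
  simpa using h

theorem antipode_iterate_deriv (n : ℕ) (a : A) :
    H.antipode (H.deriv^[n] a) = H.deriv^[n] (H.antipode a) :=
  Function.Commute.iterate_right (f := H.antipode) H.antipode_deriv n a

open scoped Classical in
/-- If `A` is generated by a finite set under multiplication, derivation and coinverse, and the
coinverse is an involution, then `A` is finitely `∂`-generated. -/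
theorem isFinDiffGenerated_of_generates (hS : ∀ a, H.antipode (H.antipode a) = a) (G : Finset A)
    (hG : ∀ N : Submodule k A, H.one ∈ N → (∀ a ∈ N, ∀ b ∈ N, H.mul a b ∈ N) →
      (∀ a ∈ N, H.deriv a ∈ N) → (∀ a ∈ N, H.antipode a ∈ N) → (∀ x ∈ G, x ∈ N) → N = ⊤) :
    H.IsFinDiffGenerated := by
  -- Stable under the coinverse because the coinverse is an involution.
  set G' : Finset A := G ∪ G.image H.antipode with hG'
  have hG'S : ∀ x ∈ G', H.antipode x ∈ G' := by
    intro x hx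
    rcases Finset.mem_union.1 hx with hx | hx
    · exact Finset.mem_union_right _ (Finset.mem_image_of_mem _ hx)
    · obtain ⟨y, hy, rfl⟩ := Finset.mem_image.1 hx
      rw [hS]
      exact Finset.mem_union_left _ hy
  let Q : Submodule k A → Prop := fun N => H.one ∈ N ∧ (∀ a ∈ N, ∀ b ∈ N, H.mul a b ∈ N) ∧
    ∀ x ∈ G', ∀ n : ℕ, H.deriv^[n] x ∈ N
  let M : Submodule k A := sInf {N | Q N}
  have hM : Q M := by
    refine ⟨Submodule.mem_sInf.2 fun N hN => hN.1, fun a ha b hb => ?_, fun x hx n => ?_⟩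
    · exact Submodule.mem_sInf.2 fun N hN =>
        hN.2.1 a (Submodule.mem_sInf.1 ha N hN) b (Submodule.mem_sInf.1 hb N hN)
    · exact Submodule.mem_sInf.2 fun N hN => hN.2.2 x hx n
  have hle : ∀ N, Q N → M ≤ N := fun N hN => sInf_le hN
  have hder : ∀ a ∈ M, H.deriv a ∈ M := by
    -- The derivation is only additive, so the preimage of `M` under it need not be a subspace.
    -- Intersected with `M` it is one, by the Leibniz rule for scalars, and it again satisfies `Q`.
    let N : Submodule k A :=
      { carrier := {a | a ∈ M ∧ H.deriv a ∈ M}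
        add_mem' := fun {a b} ha hb =>
          ⟨M.add_mem ha.1 hb.1, by rw [map_add]; exact M.add_mem ha.2 hb.2⟩
        zero_mem' := ⟨M.zero_mem, by rw [map_zero]; exact M.zero_mem⟩
        smul_mem' := fun c a ha => ⟨M.smul_mem c ha.1, by
          rw [H.deriv_smul]
          exact M.add_mem (M.smul_mem _ ha.1) (M.smul_mem _ ha.2)⟩ }
    have hN : Q N := by
      refine ⟨⟨hM.1, by rw [H.deriv_one]; exact M.zero_mem⟩, fun a ha b hb => ⟨?_, ?_⟩,
        fun x hx n => ⟨hM.2.2 x hx n, ?_⟩⟩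
      · exact hM.2.1 a ha.1 b hb.1
      · rw [H.deriv_mul]
        exact M.add_mem (hM.2.1 _ ha.2 _ hb.1) (hM.2.1 _ ha.1 _ hb.2)
      · rw [← Function.iterate_succ_apply' H.deriv]
        exact hM.2.2 x hx (n + 1)
    exact fun a ha => (hle N hN ha).2
  have hant : ∀ a ∈ M, H.antipode a ∈ M := by
    refine hle (M.comap H.antipode) ⟨?_, fun a ha b hb => ?_, fun x hx n => ?_⟩
    · rw [Submodule.mem_comap, H.antipode_one]
      exact hM.1
    · rw [Submodule.mem_comap, H.antipode_mul]
      exact hM.2.1 _ ha _ hb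
    · rw [Submodule.mem_comap, H.antipode_iterate_deriv]
      exact hM.2.2 _ (hG'S x hx) n
  have htop : M = ⊤ := hG M hM.1 hM.2.1 hder hant fun x hx =>
    hM.2.2 x (Finset.mem_union_left _ hx) 0
  exact ⟨G', fun N h₁ h₂ h₃ => top_le_iff.1 (htop ▸ hle N ⟨h₁, h₂, h₃⟩)⟩

end DiffHopfStructure

/-- The canonical element of `V ⊗ V^*` is preserved by linear maps: if `∑ p_s(z) x_s = z` on `V` and
`∑ q_r(z) y_r = z` on `W`, then `∑ f(x_s) ⊗ p_s = ∑ y_r ⊗ (q_r ∘ f)` in `W ⊗ V^*`. -/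
theorem sum_dual_natural {k V W M ι κ : Type*} [Field k] [AddCommGroup V] [Module k V]
    [AddCommGroup W] [Module k W] [AddCommGroup M] [Module k M] [Fintype ι] [Fintype κ]
    (β : W →ₗ[k] Module.Dual k V →ₗ[k] M) (f : V →ₗ[k] W)
    (x : ι → V) (p : ι → Module.Dual k V) (hx : ∀ z, ∑ s, p s z • x s = z)
    (y : κ → W) (q : κ → Module.Dual k W) (hy : ∀ z, ∑ r, q r z • y r = z) :
    ∑ s, β (f (x s)) (p s) = ∑ r, β (y r) (q r ∘ₗ f) := by
  have h₁ : ∀ s, β (f (x s)) (p s) = ∑ r, q r (f (x s)) • β (y r) (p s) := fun s => by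
    conv_lhs => rw [← hy (f (x s))]
    simp
  have h₂ : ∀ r, q r ∘ₗ f = ∑ s, q r (f (x s)) • p s := fun r => by
    ext z
    conv_lhs => rw [← hx z]
    simp [mul_comm]
  simp only [h₁, h₂, map_sum, map_smul]
  exact Finset.sum_comm

variable {k : Type u} [Field k] [Differential k]
variable {C : Type u₁} [Category.{v₁} C] [Abelian C] [MonoidalCategory C]
  [SymmetricCategory C] [RigidCategory C] [Linear k C]

namespace FiberData

variable (T : FiberData k C)

/-! ### The fiber functor on elements -/

theorem ωmap_id (X : C) : T.ωmap (𝟙 X) = LinearMap.id :=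
  congrArg (fun f => f.hom.hom) (T.ω.map_id X)

theorem ωmap_comp {X Y Z : C} (f : X ⟶ Y) (g : Y ⟶ Z) :
    T.ωmap (f ≫ g) = T.ωmap g ∘ₗ T.ωmap f :=
  congrArg (fun f => f.hom.hom) (T.ω.map_comp f g)

theorem ωmap_comp_apply {X Y Z : C} (f : X ⟶ Y) (g : Y ⟶ Z) (x : T.ω.obj X) :
    T.ωmap (f ≫ g) x = T.ωmap g (T.ωmap f x) :=
  LinearMap.congr_fun (T.ωmap_comp f g) x

theorem ωmap_add {X Y : C} (f g : X ⟶ Y) : T.ωmap (f + g) = T.ωmap f + T.ωmap g :=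
  congrArg (fun f => f.hom.hom) (T.ω.map_add (f := f) (g := g))

/-- Left exactness of `ω` preserves monomorphisms, and in `ModuleCat` these are the injective maps.
-/
theorem ωmap_injective {X Y : C} (f : X ⟶ Y) [Mono f] : Function.Injective (T.ωmap f) := by
  have : Mono ((forget₂ (FGModuleCat k) (ModuleCat k)).map (T.ω.map f)) := inferInstance
  exact (ModuleCat.mono_iff_injective _).1 this

theorem ωmap_surjective {X Y : C} (f : X ⟶ Y) [Epi f] : Function.Surjective (T.ωmap f) := by
  have : Epi ((forget₂ (FGModuleCat k) (ModuleCat k)).map (T.ω.map f)) := inferInstance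
  exact (ModuleCat.epi_iff_surjective _).1 this

theorem tensorFrom_tensorTo {X Y : C} (x : T.ω.obj X ⊗[k] T.ω.obj Y) :
    T.tensorFrom X Y (T.tensorTo X Y x) = x :=
  LinearMap.congr_fun (congrArg (fun f => f.hom.hom) (Functor.Monoidal.μ_δ T.ω X Y)) x

theorem tensorTo_tensorFrom {X Y : C} (x : T.ω.obj (X ⊗ Y)) :
    T.tensorTo X Y (T.tensorFrom X Y x) = x :=
  LinearMap.congr_fun (congrArg (fun f => f.hom.hom) (Functor.Monoidal.δ_μ T.ω X Y)) x

theorem unitFrom_unitTo (c : k) : T.unitFrom (T.unitTo c) = c :=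
  LinearMap.congr_fun (congrArg (fun f => f.hom.hom) (Functor.Monoidal.ε_η T.ω)) c

theorem unitTo_unitFrom (x : T.ω.obj (𝟙_ C)) : T.unitTo (T.unitFrom x) = x :=
  LinearMap.congr_fun (congrArg (fun f => f.hom.hom) (Functor.Monoidal.η_ε T.ω)) x

theorem ωmap_tensorHom {X Y X' Y' : C} (f : X ⟶ X') (g : Y ⟶ Y') (v : T.ω.obj X)
    (w : T.ω.obj Y) :
    T.ωmap (f ⊗ₘ g) (T.tensorTo X Y (v ⊗ₜ w)) =
      T.tensorTo X' Y' (T.ωmap f v ⊗ₜ T.ωmap g w) :=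
  (LinearMap.congr_fun (congrArg (fun f => f.hom.hom)
    (Functor.LaxMonoidal.μ_natural T.ω f g)) (v ⊗ₜ[k] w)).symm

theorem ωmap_whiskerRight {X X' : C} (f : X ⟶ X') (Y : C) (v : T.ω.obj X) (w : T.ω.obj Y) :
    T.ωmap (f ▷ Y) (T.tensorTo X Y (v ⊗ₜ w)) = T.tensorTo X' Y (T.ωmap f v ⊗ₜ w) := by
  rw [← tensorHom_id, ωmap_tensorHom, ωmap_id]; rfl

theorem ωmap_whiskerLeft (X : C) {Y Y' : C} (f : Y ⟶ Y') (v : T.ω.obj X) (w : T.ω.obj Y) :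
    T.ωmap (X ◁ f) (T.tensorTo X Y (v ⊗ₜ w)) = T.tensorTo X Y' (v ⊗ₜ T.ωmap f w) := by
  rw [← id_tensorHom, ωmap_tensorHom, ωmap_id]; rfl

theorem ωmap_associator (X Y Z : C) (x : T.ω.obj X) (y : T.ω.obj Y) (z : T.ω.obj Z) :
    T.ωmap (α_ X Y Z).hom (T.tensorTo (X ⊗ Y) Z (T.tensorTo X Y (x ⊗ₜ y) ⊗ₜ z)) =
      T.tensorTo X (Y ⊗ Z) (x ⊗ₜ T.tensorTo Y Z (y ⊗ₜ z)) :=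
  LinearMap.congr_fun (congrArg (fun f => f.hom.hom)
    (Functor.LaxMonoidal.associativity T.ω X Y Z)) ((x ⊗ₜ[k] y) ⊗ₜ[k] z)

theorem ωmap_leftUnitor (X : C) (c : k) (x : T.ω.obj X) :
    T.ωmap (λ_ X).hom (T.tensorTo (𝟙_ C) X (T.unitTo c ⊗ₜ x)) = c • x :=
  (LinearMap.congr_fun (congrArg (fun f => f.hom.hom)
    (Functor.LaxMonoidal.left_unitality T.ω X)) (c ⊗ₜ[k] x)).symm

theorem ωmap_rightUnitor (X : C) (c : k) (x : T.ω.obj X) :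
    T.ωmap (ρ_ X).hom (T.tensorTo X (𝟙_ C) (x ⊗ₜ T.unitTo c)) = c • x :=
  (LinearMap.congr_fun (congrArg (fun f => f.hom.hom)
    (Functor.LaxMonoidal.right_unitality T.ω X)) (x ⊗ₜ[k] c)).symm

theorem ωmap_braiding (X Y : C) (x : T.ω.obj X) (y : T.ω.obj Y) :
    T.ωmap (β_ X Y).hom (T.tensorTo X Y (x ⊗ₜ y)) = T.tensorTo Y X (y ⊗ₜ x) :=
  (LinearMap.congr_fun (congrArg (fun f => f.hom.hom)
    (Functor.LaxBraided.braided (F := T.ω) X Y)) (x ⊗ₜ[k] y))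

theorem dualTensor_tensorTo {X Y : C} (u : Module.Dual k (T.ω.obj X))
    (t : Module.Dual k (T.ω.obj Y)) (v : T.ω.obj X) (w : T.ω.obj Y) :
    T.dualTensor u t (T.tensorTo X Y (v ⊗ₜ w)) = u v * t w := by
  simp [dualTensor, tensorFrom_tensorTo]

/-- Linear maps on `ω(X ⊗ Y)` that agree on the elements `v ⊗ w` are equal. -/
theorem tensor_hom_ext {X Y : C} {M : Type*} [AddCommGroup M] [Module k M]
    {f g : T.ω.obj (X ⊗ Y) →ₗ[k] M}
    (h : ∀ v w, f (T.tensorTo X Y (v ⊗ₜ w)) = g (T.tensorTo X Y (v ⊗ₜ w))) : f = g := by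
  ext x
  rw [← T.tensorTo_tensorFrom x]
  refine LinearMap.congr_fun (f := f ∘ₗ T.tensorTo X Y) (g := g ∘ₗ T.tensorTo X Y) ?_ _
  exact TensorProduct.ext' h

/-- Linear maps on `ω(𝟙)` that agree on the canonical generator are equal. -/
theorem unit_hom_ext {M : Type*} [AddCommGroup M] [Module k M]
    {f g : T.ω.obj (𝟙_ C) →ₗ[k] M} (h : f (T.unitTo 1) = g (T.unitTo 1)) : f = g := by
  ext x
  rw [← T.unitTo_unitFrom x]
  refine LinearMap.congr_fun (f := f ∘ₗ T.unitTo) (g := g ∘ₗ T.unitTo) ?_ _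
  exact LinearMap.ext_ring h

/-! ### Duals -/

theorem toDual_apply {X : C} (ξ : T.ω.obj (Xᘁ)) (v : T.ω.obj X) :
    T.toDual X ξ v =
      T.unitFrom (T.ωmap (ExactPairing.evaluation X (Xᘁ)) (T.tensorTo (Xᘁ) X (ξ ⊗ₜ v))) :=
  rfl

/-- A pairing `Z ⊗ V ⟶ 𝟙` is induced by a morphism `Z ⟶ V^*`. -/
theorem exists_hom_toDual {Z V : C} (e : Z ⊗ V ⟶ 𝟙_ C) :
    ∃ h : Z ⟶ Vᘁ, ∀ z v, T.toDual V (T.ωmap h z) v =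
      T.unitFrom (T.ωmap e (T.tensorTo Z V (z ⊗ₜ v))) := by
  obtain ⟨h, rfl⟩ : ∃ h : Z ⟶ Vᘁ, h ▷ V ≫ ExactPairing.evaluation V (Vᘁ) = e := by
    -- The mate of `e` under the adjunction between tensoring with `V` and with its dual, followed
    -- by removal of the unit factor.
    refine ⟨(tensorRightHomEquiv Z V (Vᘁ) (𝟙_ C)) e ≫ (λ_ _).hom, ?_⟩
    conv_rhs => rw [← (tensorRightHomEquiv Z V (Vᘁ) (𝟙_ C)).symm_apply_apply e]
    change _ = _ ▷ _ ≫ (α_ _ _ _).hom ≫ _ ◁ ExactPairing.evaluation _ _ ≫ (ρ_ _).hom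
    monoidal
  exact ⟨h, fun z v => by rw [toDual_apply, ωmap_comp_apply, ωmap_whiskerRight]⟩

/-- The coevaluation, as an element of `ω(V) ⊗ ω(V^*)`. -/
def coev (V : C) : T.ω.obj V ⊗[k] T.ω.obj (Vᘁ) :=
  T.tensorFrom V (Vᘁ) (T.ωmap (ExactPairing.coevaluation V (Vᘁ)) (T.unitTo 1))

theorem tensorTo_coev (V : C) : T.tensorTo V (Vᘁ) (T.coev V) =
    T.ωmap (ExactPairing.coevaluation V (Vᘁ)) (T.unitTo 1) :=
  T.tensorTo_tensorFrom _

theorem ωmap_associator_inv (X Y Z : C) (x : T.ω.obj X) (y : T.ω.obj Y) (z : T.ω.obj Z) :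
    T.ωmap (α_ X Y Z).inv (T.tensorTo X (Y ⊗ Z) (x ⊗ₜ T.tensorTo Y Z (y ⊗ₜ z))) =
      T.tensorTo (X ⊗ Y) Z (T.tensorTo X Y (x ⊗ₜ y) ⊗ₜ z) := by
  rw [← ωmap_associator, ← ωmap_comp_apply, Iso.hom_inv_id, ωmap_id]; rfl

/-- This is the image under `ω` of a zigzag identity for the exact pairing of `V` and its dual. -/
theorem coev_left (V : C) (v : T.ω.obj V) :
    TensorProduct.rid k _ (TensorProduct.map LinearMap.id ((T.toDual V).flip v) (T.coev V)) =
      v := by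
  -- An arbitrary tensor replaces the coevaluation, so that linearity reduces the computation to
  -- decomposable tensors.
  have key : ∀ t : T.ω.obj V ⊗[k] T.ω.obj (Vᘁ),
      T.ωmap ((α_ V (Vᘁ) V).hom ≫ V ◁ ExactPairing.evaluation V (Vᘁ) ≫ (ρ_ V).hom)
        (T.tensorTo (V ⊗ Vᘁ) V (T.tensorTo V (Vᘁ) t ⊗ₜ v)) =
      TensorProduct.rid k _ (TensorProduct.map LinearMap.id ((T.toDual V).flip v) t) := by
    intro t
    induction t with
    | zero => simp
    | add a b ha hb => simp only [map_add, TensorProduct.add_tmul, ha, hb]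
    | tmul x ξ =>
      rw [ωmap_comp_apply, ωmap_comp_apply, ωmap_associator, ωmap_whiskerLeft,
        ← T.unitTo_unitFrom (T.ωmap (ExactPairing.evaluation V (Vᘁ)) _), ← toDual_apply,
        ωmap_rightUnitor]
      simp
  rw [← key, tensorTo_coev, ← ωmap_whiskerRight, ← ωmap_comp_apply]
  have h : ExactPairing.coevaluation V (Vᘁ) ▷ V ≫
      (α_ V (Vᘁ) V).hom ≫ V ◁ ExactPairing.evaluation V (Vᘁ) ≫ (ρ_ V).hom = (λ_ V).hom := by
    simp
  rw [h, ωmap_leftUnitor, one_smul]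

/-- The other zigzag identity, on the dual object. -/
theorem coev_right (V : C) (ξ : T.ω.obj (Vᘁ)) :
    TensorProduct.lid k _ (TensorProduct.map (T.toDual V ξ) LinearMap.id (T.coev V)) = ξ := by
  have key : ∀ t : T.ω.obj V ⊗[k] T.ω.obj (Vᘁ),
      T.ωmap ((α_ (Vᘁ) V (Vᘁ)).inv ≫ ExactPairing.evaluation V (Vᘁ) ▷ Vᘁ ≫ (λ_ (Vᘁ)).hom)
        (T.tensorTo (Vᘁ) (V ⊗ Vᘁ) (ξ ⊗ₜ T.tensorTo V (Vᘁ) t)) =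
      TensorProduct.lid k _ (TensorProduct.map (T.toDual V ξ) LinearMap.id t) := by
    intro t
    induction t with
    | zero => simp
    | add a b ha hb => simp only [map_add, TensorProduct.tmul_add, ha, hb]
    | tmul x η =>
      rw [ωmap_comp_apply, ωmap_comp_apply, ωmap_associator_inv, ωmap_whiskerRight,
        ← T.unitTo_unitFrom (T.ωmap (ExactPairing.evaluation V (Vᘁ)) _), ← toDual_apply,
        ωmap_leftUnitor]
      simp
  rw [← key, tensorTo_coev, ← ωmap_whiskerLeft, ← ωmap_comp_apply]
  have h : Vᘁ ◁ ExactPairing.coevaluation V (Vᘁ) ≫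
      (α_ (Vᘁ) V (Vᘁ)).inv ≫ ExactPairing.evaluation V (Vᘁ) ▷ Vᘁ ≫ (λ_ (Vᘁ)).hom =
        (ρ_ (Vᘁ)).hom := by
    simp
  rw [h, ωmap_rightUnitor, one_smul]

/-- By the zigzag identities, contracting the first leg of the coevaluation with a functional
inverts `toDual`. -/
theorem toDual_bijective (V : C) : Function.Bijective (T.toDual V) := by
  constructor
  · refine (injective_iff_map_eq_zero _).2 fun ξ hξ => ?_
    rw [← T.coev_right V ξ, hξ, TensorProduct.map_zero_left]
    simp
  · intro u
    refine ⟨TensorProduct.lid k _ (TensorProduct.map u LinearMap.id (T.coev V)), ?_⟩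
    ext v
    conv_rhs => rw [← T.coev_left V v]
    generalize T.coev V = t
    induction t with
    | zero => simp
    | add a b ha hb => simp only [map_add, LinearMap.add_apply, ha, hb]
    | tmul x ξ => simp [mul_comm]

/-- The identification `ω(X^*) ≃ ω(X)^*`. -/
def dualEquiv (V : C) : T.ω.obj (Vᘁ) ≃ₗ[k] Module.Dual k (T.ω.obj V) :=
  LinearEquiv.ofBijective (T.toDual V) (T.toDual_bijective V)

theorem toDual_dualEquiv_symm {V : C} (u : Module.Dual k (T.ω.obj V)) :
    T.toDual V ((T.dualEquiv V).symm u) = u :=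
  (T.dualEquiv V).apply_symm_apply u

theorem dualEquiv_symm_toDual {V : C} (ξ : T.ω.obj (Vᘁ)) :
    (T.dualEquiv V).symm (T.toDual V ξ) = ξ :=
  (T.dualEquiv V).symm_apply_apply ξ

/-- In terms of a basis `b` of `ω(V)`, the coevaluation is `∑ b_j ⊗ b_j^*`. -/
theorem coev_eq_sum (V : C) {n : ℕ} (b : Module.Basis (Fin n) k (T.ω.obj V)) :
    T.coev V = ∑ j, b j ⊗ₜ (T.dualEquiv V).symm (b.coord j) := by
  have h : ∀ t : T.ω.obj V ⊗[k] T.ω.obj (Vᘁ),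
      t = ∑ j, b j ⊗ₜ TensorProduct.lid k _ (TensorProduct.map (b.coord j) LinearMap.id t) := by
    intro t
    induction t with
    | zero => simp
    | add x y hx hy =>
      conv_lhs => rw [hx, hy]
      simp only [map_add, TensorProduct.tmul_add, Finset.sum_add_distrib]
    | tmul x ξ =>
      conv_lhs => rw [← b.sum_repr x, TensorProduct.sum_tmul]
      refine Finset.sum_congr rfl fun j _ => ?_
      simp [TensorProduct.smul_tmul]
  conv_lhs => rw [h (T.coev V)]
  refine Finset.sum_congr rfl fun j _ => ?_
  conv_lhs => rw [← T.toDual_dualEquiv_symm (b.coord j), coev_right]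

theorem toDual_rightAdjointMate {V W : C} (f : V ⟶ W) (ξ : T.ω.obj (Wᘁ)) :
    T.toDual V (T.ωmap (fᘁ) ξ) = T.toDual W ξ ∘ₗ T.ωmap f := by
  ext v
  rw [toDual_apply, LinearMap.comp_apply, toDual_apply, ← ωmap_whiskerRight, ← ωmap_comp_apply,
    rightAdjointMate_comp_evaluation, ωmap_comp_apply, ωmap_whiskerLeft]

/-! ### Linear algebra of matrix coefficients -/

section Coef

variable {T} {P : ObjectProperty C} {V : C} (hV : P V)

@[simp]
theorem coef_add_left (v v' : T.ω.obj V) (u : Module.Dual k (T.ω.obj V)) :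
    T.coef V hV (v + v') u = T.coef V hV v u + T.coef V hV v' u := by
  simp [coef, TensorProduct.add_tmul]

@[simp]
theorem coef_add_right (v : T.ω.obj V) (u u' : Module.Dual k (T.ω.obj V)) :
    T.coef V hV v (u + u') = T.coef V hV v u + T.coef V hV v u' := by
  simp [coef, TensorProduct.tmul_add]

@[simp]
theorem coef_smul_left (c : k) (v : T.ω.obj V) (u : Module.Dual k (T.ω.obj V)) :
    T.coef V hV (c • v) u = c • T.coef V hV v u := by
  rw [coef, ← TensorProduct.smul_tmul', map_smul, coef]

@[simp]
theorem coef_smul_right (c : k) (v : T.ω.obj V) (u : Module.Dual k (T.ω.obj V)) :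
    T.coef V hV v (c • u) = c • T.coef V hV v u := by
  rw [coef, TensorProduct.tmul_smul, map_smul, coef]

variable (T) in
/-- `a_V` as a bilinear map. -/
def coefBilin : T.ω.obj V →ₗ[k] Module.Dual k (T.ω.obj V) →ₗ[k] T.CoefSpace P :=
  LinearMap.mk₂ k (T.coef V hV) (coef_add_left hV) (coef_smul_left hV) (coef_add_right hV)
    (coef_smul_right hV)

theorem coefBilin_apply (v : T.ω.obj V) (u : Module.Dual k (T.ω.obj V)) :
    T.coefBilin hV v u = T.coef V hV v u := rfl

theorem coef_sum_left {ι : Type*} (s : Finset ι) (v : ι → T.ω.obj V)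
    (u : Module.Dual k (T.ω.obj V)) :
    T.coef V hV (∑ i ∈ s, v i) u = ∑ i ∈ s, T.coef V hV (v i) u := by
  simp only [← coefBilin_apply, map_sum, LinearMap.sum_apply]

theorem coef_sum_right {ι : Type*} (s : Finset ι) (v : T.ω.obj V)
    (u : ι → Module.Dual k (T.ω.obj V)) :
    T.coef V hV v (∑ i ∈ s, u i) = ∑ i ∈ s, T.coef V hV v (u i) := by
  simp only [← coefBilin_apply, map_sum]

end Coef

open scoped Classical in
/-- The matrix coefficients span. -/
theorem coef_induction {P : ObjectProperty C} {p : T.CoefSpace P → Prop} (zero : p 0)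
    (add : ∀ a b, p a → p b → p (a + b))
    (coef : ∀ V (hV : P V) v u, p (T.coef V hV v u)) (a : T.CoefSpace P) : p a := by
  obtain ⟨z, rfl⟩ := (T.coefRel P).mkQ_surjective a
  induction z using DirectSum.induction_on with
  | zero => rw [map_zero]; exact zero
  | add x y hx hy => rw [map_add]; exact add _ _ hx hy
  | of V x =>
    induction x with
    | zero => rw [map_zero, map_zero]; exact zero
    | add x y hx hy => rw [map_add, map_add]; exact add _ _ hx hy
    | tmul v u => exact coef V.1 V.2 v u

theorem coef_hom_ext {P : ObjectProperty C} {M : Type*} [AddCommGroup M] [Module k M]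
    {f g : T.CoefSpace P →ₗ[k] M}
    (h : ∀ V (hV : P V) v u, f (T.coef V hV v u) = g (T.coef V hV v u)) : f = g := by
  ext a
  induction a using T.coef_induction with
  | zero => simp
  | add a b ha hb => simp [ha, hb]
  | coef V hV v u => exact h V hV v u

open scoped Classical in
/-- The universal property of the space of matrix coefficients. -/
def coefLift {P : ObjectProperty C} {M : Type*} [AddCommGroup M] [Module k M]
    (β : ∀ V, P V → T.ω.obj V →ₗ[k] Module.Dual k (T.ω.obj V) →ₗ[k] M)
    (h : ∀ V W (hV : P V) (hW : P W) (f : V ⟶ W) v u,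
      β V hV v (u ∘ₗ T.ωmap f) = β W hW (T.ωmap f v) u) : T.CoefSpace P →ₗ[k] M :=
  (T.coefRel P).liftQ
    (DirectSum.toModule k {V : C // P V} M fun V => TensorProduct.lift (β V.1 V.2)) (by
      refine Submodule.span_le.2 ?_
      rintro _ ⟨V, W, f, v, u, rfl⟩
      simp only [SetLike.mem_coe, LinearMap.mem_ker, map_sub, DirectSum.toModule_lof,
        TensorProduct.lift.tmul]
      exact sub_eq_zero.2 (h V.1 W.1 V.2 W.2 f v u))

theorem coefLift_coef {P : ObjectProperty C} {M : Type*} [AddCommGroup M] [Module k M]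
    (β : ∀ V, P V → T.ω.obj V →ₗ[k] Module.Dual k (T.ω.obj V) →ₗ[k] M)
    (h : ∀ V W (hV : P V) (hW : P W) (f : V ⟶ W) v u,
      β V hV v (u ∘ₗ T.ωmap f) = β W hW (T.ωmap f v) u)
    {V : C} (hV : P V) (v : T.ω.obj V) (u : Module.Dual k (T.ω.obj V)) :
    T.coefLift β h (T.coef V hV v u) = β V hV v u := by
  classical
  change (DirectSum.toModule k {V : C // P V} M fun V => TensorProduct.lift (β V.1 V.2))
    (DirectSum.lof k {V : C // P V}
      (fun V => T.ω.obj V.1 ⊗[k] Module.Dual k (T.ω.obj V.1)) ⟨V, hV⟩ (v ⊗ₜ[k] u)) = _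
  rw [DirectSum.toModule_lof, TensorProduct.lift.tmul]

/-! ### Multiplication -/

section DualTensor

variable {T} {X Y : C} (u u' : Module.Dual k (T.ω.obj X)) (t t' : Module.Dual k (T.ω.obj Y)) (c : k)

theorem dualTensor_add_left : T.dualTensor (u + u') t = T.dualTensor u t + T.dualTensor u' t :=
  T.tensor_hom_ext fun v w => by simp [dualTensor_tensorTo, add_mul]

theorem dualTensor_add_right : T.dualTensor u (t + t') = T.dualTensor u t + T.dualTensor u t' :=
  T.tensor_hom_ext fun v w => by simp [dualTensor_tensorTo, mul_add]

theorem dualTensor_smul_left : T.dualTensor (c • u) t = c • T.dualTensor u t :=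
  T.tensor_hom_ext fun v w => by simp [dualTensor_tensorTo, mul_assoc]

theorem dualTensor_smul_right : T.dualTensor u (c • t) = c • T.dualTensor u t :=
  T.tensor_hom_ext fun v w => by simp [dualTensor_tensorTo, mul_left_comm]

theorem dualTensor_comp_tensorHom {X' Y' : C} (f : X' ⟶ X) (g : Y' ⟶ Y) :
    T.dualTensor u t ∘ₗ T.ωmap (f ⊗ₘ g) = T.dualTensor (u ∘ₗ T.ωmap f) (t ∘ₗ T.ωmap g) :=
  T.tensor_hom_ext fun v w => by simp [dualTensor_tensorTo, ωmap_tensorHom]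

end DualTensor

section Operations

variable {P : ObjectProperty C} (hP : T.IsDiffTensorClosed P)

/-- The bilinear map `(w, t) ↦ a_{V ⊗ W}((v ⊗ w) ⊗ (u ⊗ t))`. -/
def coefMulLeft {V W : C} (hV : P V) (hW : P W) (v : T.ω.obj V) (u : Module.Dual k (T.ω.obj V)) :
    T.ω.obj W →ₗ[k] Module.Dual k (T.ω.obj W) →ₗ[k] T.CoefSpace P :=
  LinearMap.mk₂ k (fun w t => T.coef (V ⊗ W) (hP.tensor hV hW) (T.tensorTo V W (v ⊗ₜ w))
      (T.dualTensor u t))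
    (fun w w' t => by simp [TensorProduct.tmul_add])
    (fun c w t => by simp)
    (fun w t t' => by simp [dualTensor_add_right])
    (fun c w t => by simp [dualTensor_smul_right])

theorem coefMulLeft_apply {V W : C} (hV : P V) (hW : P W) (v : T.ω.obj V)
    (u : Module.Dual k (T.ω.obj V)) (w : T.ω.obj W) (t : Module.Dual k (T.ω.obj W)) :
    T.coefMulLeft hP hV hW v u w t =
      T.coef (V ⊗ W) (hP.tensor hV hW) (T.tensorTo V W (v ⊗ₜ w)) (T.dualTensor u t) := rfl

/-- The coefficient relation for `f ⊗ g`. Taking one of the two morphisms to be an identity shows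
that the product respects the relations in each argument. -/
theorem coef_tensor_natural {V W V' W' : C} (hV : P V) (hW : P W) (hV' : P V') (hW' : P W')
    (f : V ⟶ V') (g : W ⟶ W') (v : T.ω.obj V) (w : T.ω.obj W) (u : Module.Dual k (T.ω.obj V'))
    (t : Module.Dual k (T.ω.obj W')) :
    T.coef (V ⊗ W) (hP.tensor hV hW) (T.tensorTo V W (v ⊗ₜ w))
        (T.dualTensor (u ∘ₗ T.ωmap f) (t ∘ₗ T.ωmap g)) =
      T.coef (V' ⊗ W') (hP.tensor hV' hW')
        (T.tensorTo V' W' (T.ωmap f v ⊗ₜ T.ωmap g w)) (T.dualTensor u t) := by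
  rw [← dualTensor_comp_tensorHom, T.coef_comp _ (hP.tensor hV' hW'), ωmap_tensorHom]

/-- Multiplication of matrix coefficients. -/
def coefMul : T.CoefSpace P →ₗ[k] T.CoefSpace P →ₗ[k] T.CoefSpace P :=
  T.coefLift
    (fun V hV => LinearMap.mk₂ k
      (fun v u => T.coefLift (fun W hW => T.coefMulLeft hP hV hW v u) fun W W' hW hW' g w t => by
        simpa [coefMulLeft_apply, ωmap_id] using T.coef_tensor_natural hP hV hW hV hW' (𝟙 V) g v w u t)
      (fun v v' u => T.coef_hom_ext fun W hW w t => by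
        simp [coefLift_coef, coefMulLeft_apply, TensorProduct.add_tmul])
      (fun c v u => T.coef_hom_ext fun W hW w t => by
        simp [coefLift_coef, coefMulLeft_apply, ← TensorProduct.smul_tmul'])
      (fun v u u' => T.coef_hom_ext fun W hW w t => by
        simp [coefLift_coef, coefMulLeft_apply, dualTensor_add_left])
      (fun c v u => T.coef_hom_ext fun W hW w t => by
        simp [coefLift_coef, coefMulLeft_apply, dualTensor_smul_left]))
    fun V V' hV hV' f v u => T.coef_hom_ext fun W hW w t => by
      simpa [coefLift_coef, coefMulLeft_apply, ωmap_id] using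
        T.coef_tensor_natural hP hV hW hV' hW f (𝟙 W) v w u t

theorem coefMul_coef {V W : C} (hV : P V) (hW : P W) (v : T.ω.obj V)
    (u : Module.Dual k (T.ω.obj V)) (w : T.ω.obj W) (t : Module.Dual k (T.ω.obj W)) :
    T.coefMul hP (T.coef V hV v u) (T.coef W hW w t) =
      T.coef (V ⊗ W) (hP.tensor hV hW) (T.tensorTo V W (v ⊗ₜ[k] w)) (T.dualTensor u t) := by
  rw [coefMul, coefLift_coef, LinearMap.mk₂_apply, coefLift_coef, coefMulLeft_apply]

/-- The unit element. -/
def coefOne : T.CoefSpace P := T.coef (𝟙_ C) hP.unit (T.unitTo 1) T.unitFrom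

/-- The functor `ω` sends the braiding to the flip, so the coefficient relation for the braiding
exchanges the factors. -/
theorem coefMul_comm (a b : T.CoefSpace P) : T.coefMul hP a b = T.coefMul hP b a := by
  induction a using T.coef_induction with
  | zero => simp
  | add a a' ha hb => simp [ha, hb]
  | coef V hV v u =>
  induction b using T.coef_induction with
  | zero => simp
  | add a a' ha hb => simp [ha, hb]
  | coef W hW w t =>
  rw [coefMul_coef, coefMul_coef, ← ωmap_braiding, ← T.coef_comp (hP.tensor hW hV)]
  congr 1
  exact T.tensor_hom_ext fun v w => by simp [dualTensor_tensorTo, ωmap_braiding, mul_comm]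

theorem coefMul_assoc (a b c : T.CoefSpace P) :
    T.coefMul hP (T.coefMul hP a b) c = T.coefMul hP a (T.coefMul hP b c) := by
  induction a using T.coef_induction with
  | zero => simp
  | add a a' ha hb => simp [ha, hb]
  | coef V hV v u =>
  induction b using T.coef_induction with
  | zero => simp
  | add a a' ha hb => simp [ha, hb]
  | coef W hW w t =>
  induction c using T.coef_induction with
  | zero => simp
  | add a a' ha hb => simp [ha, hb]
  | coef X hX x s =>
  simp only [coefMul_coef]
  rw [← ωmap_associator, ← T.coef_comp (hP.tensor (hP.tensor hV hW) hX)]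
  congr 1
  refine T.tensor_hom_ext fun y z => ?_
  -- For fixed `z` both sides are linear in `y`, which lies in `ω(V ⊗ W)`; hence extensionality on
  -- decomposable tensors applies a second time.
  refine LinearMap.congr_fun (T.tensor_hom_ext
    (f := (T.dualTensor (T.dualTensor u t) s ∘ₗ T.tensorTo (V ⊗ W) X) ∘ₗ
      (TensorProduct.mk k _ _).flip z)
    (g := ((T.dualTensor u (T.dualTensor t s) ∘ₗ T.ωmap (α_ V W X).hom) ∘ₗ
      T.tensorTo (V ⊗ W) X) ∘ₗ (TensorProduct.mk k _ _).flip z) fun y y' => ?_) y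
  simp [dualTensor_tensorTo, ωmap_associator, mul_assoc]

theorem one_coefMul (a : T.CoefSpace P) : T.coefMul hP (T.coefOne hP) a = a := by
  induction a using T.coef_induction with
  | zero => simp
  | add a a' ha hb => simp [ha, hb]
  | coef V hV v u =>
  rw [coefOne, coefMul_coef]
  conv_rhs => rw [← one_smul k v, ← ωmap_leftUnitor, ← T.coef_comp (hP.tensor hP.unit hV)]
  congr 1
  refine T.tensor_hom_ext fun y z => ?_
  rw [← T.unitTo_unitFrom y]
  simp [dualTensor_tensorTo, ωmap_leftUnitor, unitFrom_unitTo]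

end Operations

/-! ### Comultiplication and counit -/

section Coalgebra

variable (P : ObjectProperty C)

/-- The bilinear map `(y, q) ↦ a_W(y ⊗ u) ⊗ a_V(v ⊗ q)`. -/
def coefTmul {P : ObjectProperty C} {V W : C} (hV : P V) (hW : P W) (v : T.ω.obj V)
    (u : Module.Dual k (T.ω.obj W)) :
    T.ω.obj W →ₗ[k] Module.Dual k (T.ω.obj V) →ₗ[k] T.CoefSpace P ⊗[k] T.CoefSpace P :=
  (TensorProduct.mk k _ _).compl₁₂ ((T.coefBilin hW).flip u) (T.coefBilin hV v)

theorem coefTmul_apply {P : ObjectProperty C} {V W : C} (hV : P V) (hW : P W) (v : T.ω.obj V)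
    (u : Module.Dual k (T.ω.obj W)) (y : T.ω.obj W) (q : Module.Dual k (T.ω.obj V)) :
    T.coefTmul hV hW v u y q = T.coef W hW y u ⊗ₜ T.coef V hV v q := rfl

/-- For general `f` this makes the comultiplication well defined; for `f = 𝟙 V` it makes it
independent of the chosen resolution of the identity. The families need not be bases. -/
theorem sum_coef_tmul_natural {P : ObjectProperty C} {V W : C} (hV : P V) (hW : P W) (f : V ⟶ W)
    (v : T.ω.obj V) (u : Module.Dual k (T.ω.obj W)) {ι κ : Type*} [Fintype ι] [Fintype κ]
    (x : ι → T.ω.obj V) (p : ι → Module.Dual k (T.ω.obj V)) (hx : ∀ z, ∑ s, p s z • x s = z)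
    (y : κ → T.ω.obj W) (q : κ → Module.Dual k (T.ω.obj W)) (hy : ∀ z, ∑ r, q r z • y r = z) :
    ∑ s, T.coef V hV (x s) (u ∘ₗ T.ωmap f) ⊗ₜ[k] T.coef V hV v (p s) =
      ∑ r, T.coef W hW (y r) u ⊗ₜ[k] T.coef W hW (T.ωmap f v) (q r) := by
  have h₁ : ∀ s, T.coef V hV (x s) (u ∘ₗ T.ωmap f) ⊗ₜ[k] T.coef V hV v (p s) =
      T.coefTmul hV hW v u (T.ωmap f (x s)) (p s) := fun s => by
    rw [coefTmul_apply, T.coef_comp hV hW]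
  have h₂ : ∀ r, T.coef W hW (y r) u ⊗ₜ[k] T.coef W hW (T.ωmap f v) (q r) =
      T.coefTmul hV hW v u (y r) (q r ∘ₗ T.ωmap f) := fun r => by
    rw [coefTmul_apply, T.coef_comp hV hW]
  rw [Finset.sum_congr rfl fun s _ => h₁ s, Finset.sum_congr rfl fun r _ => h₂ r]
  exact sum_dual_natural (T.coefTmul hV hW v u) (T.ωmap f) x p hx y q hy

theorem sum_basis_coord {V ι : Type*} [AddCommGroup V] [Module k V] [Fintype ι]
    (b : Module.Basis ι k V) (z : V) : ∑ j, b.coord j z • b j = z :=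
  b.sum_repr z

variable {P} in
/-- The bilinear map `(v, u) ↦ ∑ a_V(v_j ⊗ u) ⊗ a_V(v ⊗ u_j)`. -/
def coefComulBilin {V : C} (hV : P V) :
    T.ω.obj V →ₗ[k] Module.Dual k (T.ω.obj V) →ₗ[k] T.CoefSpace P ⊗[k] T.CoefSpace P :=
  LinearMap.mk₂ k
    (fun v u => ∑ j, T.coef V hV (Module.finBasis k (T.ω.obj V) j) u ⊗ₜ[k]
      T.coef V hV v ((Module.finBasis k (T.ω.obj V)).coord j))
    (fun v v' u => by
      simp only [coef_add_left, TensorProduct.tmul_add, Finset.sum_add_distrib])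
    (fun c v u => by
      simp only [coef_smul_left, TensorProduct.tmul_smul, Finset.smul_sum])
    (fun v u u' => by
      simp only [coef_add_right, TensorProduct.add_tmul, Finset.sum_add_distrib])
    (fun c v u => by
      simp only [coef_smul_right, ← TensorProduct.smul_tmul', Finset.smul_sum])

theorem coefComulBilin_apply {V : C} (hV : P V) (v : T.ω.obj V) (u : Module.Dual k (T.ω.obj V)) :
    T.coefComulBilin hV v u = ∑ j, T.coef V hV (Module.finBasis k (T.ω.obj V) j) u ⊗ₜ[k]
      T.coef V hV v ((Module.finBasis k (T.ω.obj V)).coord j) := rfl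

/-- Comultiplication of matrix coefficients. -/
def coefComul : T.CoefSpace P →ₗ[k] T.CoefSpace P ⊗[k] T.CoefSpace P :=
  T.coefLift (fun V hV => T.coefComulBilin hV) fun V W hV hW f v u => by
    rw [coefComulBilin_apply, coefComulBilin_apply]
    exact T.sum_coef_tmul_natural hV hW f v u _ _ (sum_basis_coord _) _ _ (sum_basis_coord _)

theorem coefComul_coef {V : C} (hV : P V) (v : T.ω.obj V) (u : Module.Dual k (T.ω.obj V))
    {ι : Type*} [Fintype ι] (x : ι → T.ω.obj V) (p : ι → Module.Dual k (T.ω.obj V))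
    (hx : ∀ z, ∑ s, p s z • x s = z) :
    T.coefComul P (T.coef V hV v u) = ∑ s, T.coef V hV (x s) u ⊗ₜ[k] T.coef V hV v (p s) := by
  rw [coefComul, coefLift_coef, coefComulBilin_apply]
  simpa [ωmap_id] using T.sum_coef_tmul_natural hV hV (𝟙 V) v u _ _
    (sum_basis_coord (Module.finBasis k (T.ω.obj V))) x p hx

theorem coefComul_coef_basis {V : C} (hV : P V) (v : T.ω.obj V) (u : Module.Dual k (T.ω.obj V))
    {ι : Type*} [Fintype ι] (b : Module.Basis ι k (T.ω.obj V)) :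
    T.coefComul P (T.coef V hV v u) = ∑ j, T.coef V hV (b j) u ⊗ₜ[k] T.coef V hV v (b.coord j) :=
  T.coefComul_coef P hV v u _ _ (sum_basis_coord b)

/-- The counit on matrix coefficients. -/
def coefCounit : T.CoefSpace P →ₗ[k] k :=
  T.coefLift (fun V _ => Module.Dual.eval k (T.ω.obj V)) fun _ _ _ _ _ _ _ => rfl

theorem coefCounit_coef {V : C} (hV : P V) (v : T.ω.obj V) (u : Module.Dual k (T.ω.obj V)) :
    T.coefCounit P (T.coef V hV v u) = u v := by
  exact T.coefLift_coef _ _ hV v u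

/-- The coalgebra of matrix coefficients. -/
abbrev coefCoalgebra : Coalgebra k (T.CoefSpace P) where
  comul := T.coefComul P
  counit := T.coefCounit P
  coassoc := T.coef_hom_ext fun V hV v u => by
    simp only [LinearMap.comp_apply, LinearEquiv.coe_coe,
      T.coefComul_coef_basis P hV _ _ (Module.finBasis k (T.ω.obj V)), map_sum,
      LinearMap.rTensor_tmul, LinearMap.lTensor_tmul, TensorProduct.sum_tmul,
      TensorProduct.tmul_sum, TensorProduct.assoc_tmul]
    exact Finset.sum_comm
  rTensor_counit_comp_comul := T.coef_hom_ext fun V hV v u => by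
    simp only [LinearMap.comp_apply,
      T.coefComul_coef_basis P hV _ _ (Module.finBasis k (T.ω.obj V)), map_sum,
      LinearMap.rTensor_tmul, coefCounit_coef, TensorProduct.mk_apply]
    -- Every occurrence of `u` is expanded, including the one in the scalar factor, which is folded
    -- back below.
    rw [← (Module.finBasis k (T.ω.obj V)).sum_dual_apply_smul_coord u, coef_sum_right,
      TensorProduct.tmul_sum]
    refine Finset.sum_congr rfl fun j _ => ?_
    rw [coef_smul_right, ← TensorProduct.smul_tmul, (Module.finBasis k
      (T.ω.obj V)).sum_dual_apply_smul_coord u, smul_eq_mul, mul_one]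
  lTensor_counit_comp_comul := T.coef_hom_ext fun V hV v u => by
    simp only [LinearMap.comp_apply,
      T.coefComul_coef_basis P hV _ _ (Module.finBasis k (T.ω.obj V)), map_sum,
      LinearMap.lTensor_tmul, coefCounit_coef, LinearMap.flip_apply, TensorProduct.mk_apply]
    conv_rhs => rw [← sum_basis_coord (Module.finBasis k (T.ω.obj V)) v, coef_sum_left,
      TensorProduct.sum_tmul]
    refine Finset.sum_congr rfl fun j _ => ?_
    rw [coef_smul_left, TensorProduct.smul_tmul, smul_eq_mul, mul_one]

end Coalgebra

/-! ### Compatibility of the comultiplication and counit with the product -/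

section Operations

variable {P : ObjectProperty C} (hP : T.IsDiffTensorClosed P)

theorem coefComul_one : T.coefComul P (T.coefOne hP) = T.coefOne hP ⊗ₜ T.coefOne hP := by
  -- The line `ω(𝟙)` has a resolution of the identity with a single term.
  rw [coefOne, T.coefComul_coef P hP.unit _ _ (fun _ : Unit => T.unitTo 1) (fun _ => T.unitFrom)]
  · simp
  · intro z
    simp [← map_smul, unitTo_unitFrom]

theorem coefCounit_one : T.coefCounit P (T.coefOne hP) = 1 := by
  rw [coefOne, coefCounit_coef, unitFrom_unitTo]

theorem coefCounit_mul (a b : T.CoefSpace P) :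
    T.coefCounit P (T.coefMul hP a b) = T.coefCounit P a * T.coefCounit P b := by
  induction a using T.coef_induction with
  | zero => simp
  | add a a' ha hb => simp [ha, hb, add_mul]
  | coef V hV v u =>
  induction b using T.coef_induction with
  | zero => simp
  | add a a' ha hb => simp [ha, hb, mul_add]
  | coef W hW w t =>
  rw [coefMul_coef, coefCounit_coef, coefCounit_coef, coefCounit_coef, dualTensor_tensorTo]

theorem sum_dualTensor_smul_tensorTo {V W : C} {ι κ : Type*} [Fintype ι] [Fintype κ]
    (x : ι → T.ω.obj V) (p : ι → Module.Dual k (T.ω.obj V)) (hx : ∀ z, ∑ s, p s z • x s = z)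
    (y : κ → T.ω.obj W) (q : κ → Module.Dual k (T.ω.obj W)) (hy : ∀ z, ∑ r, q r z • y r = z)
    (z : T.ω.obj (V ⊗ W)) :
    ∑ s : ι × κ, T.dualTensor (p s.1) (q s.2) z • T.tensorTo V W (x s.1 ⊗ₜ y s.2) = z := by
  have h : ∑ s : ι × κ, (T.dualTensor (p s.1) (q s.2)).smulRight
      (T.tensorTo V W (x s.1 ⊗ₜ y s.2)) = LinearMap.id := T.tensor_hom_ext fun v w => by
    conv_rhs => rw [← hx v, ← hy w]
    simp only [LinearMap.sum_apply, LinearMap.smulRight_apply, dualTensor_tensorTo,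
      LinearMap.id_apply, TensorProduct.sum_tmul, TensorProduct.tmul_sum, map_sum,
      Fintype.sum_prod_type, ← TensorProduct.smul_tmul', TensorProduct.tmul_smul, map_smul]
    rw [Finset.sum_comm]
    simp only [Finset.smul_sum, smul_smul, mul_comm]
  simpa using LinearMap.congr_fun h z

/-- On `V ⊗ W` the comultiplication is computed with products of basis vectors and of coordinate
functionals; the double sum then factors. -/
theorem coefComul_mul (a b : T.CoefSpace P) : T.coefComul P (T.coefMul hP a b) =
    TensorProduct.map (TensorProduct.lift (T.coefMul hP)) (TensorProduct.lift (T.coefMul hP))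
      (TensorProduct.tensorTensorTensorComm k _ _ _ _ (T.coefComul P a ⊗ₜ[k] T.coefComul P b)) := by
  induction a using T.coef_induction with
  | zero => simp
  | add a a' ha hb => simp only [map_add, LinearMap.add_apply, ha, hb, TensorProduct.add_tmul]
  | coef V hV v u =>
  induction b using T.coef_induction with
  | zero => simp
  | add a a' ha hb => simp only [map_add, ha, hb, TensorProduct.tmul_add]
  | coef W hW w t =>
  have hV' := sum_basis_coord (Module.finBasis k (T.ω.obj V))
  have hW' := sum_basis_coord (Module.finBasis k (T.ω.obj W))
  rw [coefMul_coef,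
    T.coefComul_coef P _ _ _ _ _ (T.sum_dualTensor_smul_tensorTo _ _ hV' _ _ hW'),
    T.coefComul_coef P hV _ _ _ _ hV', T.coefComul_coef P hW _ _ _ _ hW']
  simp only [TensorProduct.sum_tmul, TensorProduct.tmul_sum, map_sum,
    TensorProduct.tensorTensorTensorComm_tmul, TensorProduct.map_tmul, TensorProduct.lift.tmul,
    coefMul_coef, Fintype.sum_prod_type]
  exact Finset.sum_comm

/-! ### Antipode -/

/-- The coinverse on matrix coefficients. -/
def coefAntipode : T.CoefSpace P →ₗ[k] T.CoefSpace P :=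
  T.coefLift
    (fun V hV => (T.coefBilin (hP.dual hV)).flip.compl₁₂ (T.toDual V).flip
      (T.dualEquiv V).symm.toLinearMap)
    fun V W hV hW f v u => by
      obtain ⟨ξ, rfl⟩ := (T.toDual_bijective W).2 u
      simp only [LinearMap.compl₁₂_apply, LinearMap.flip_apply, coefBilin_apply,
        LinearEquiv.coe_coe]
      rw [← toDual_rightAdjointMate, dualEquiv_symm_toDual, dualEquiv_symm_toDual,
        ← T.coef_comp (hP.dual hW)]
      congr 1
      ext η
      simp [toDual_rightAdjointMate]

theorem coefAntipode_coef {V : C} (hV : P V) (v : T.ω.obj V) (ξ : T.ω.obj (Vᘁ)) :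
    T.coefAntipode hP (T.coef V hV v (T.toDual V ξ)) =
      T.coef (Vᘁ) (hP.dual hV) ξ ((T.toDual V).flip v) := by
  rw [coefAntipode, coefLift_coef, LinearMap.compl₁₂_apply, LinearMap.flip_apply,
    LinearEquiv.coe_coe, dualEquiv_symm_toDual, coefBilin_apply]

/-- A pairing `e : Z ⊗ V ⟶ 𝟙` computes the coinverse: if `u = e(z, ·)`, then
`S(a_V(v ⊗ u)) = a_Z(z ⊗ e(·, v))`. -/
theorem coefAntipode_pairing {Z V : C} (hZ : P Z) (hV : P V) (e : Z ⊗ V ⟶ 𝟙_ C) (v : T.ω.obj V)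
    (u : Module.Dual k (T.ω.obj V)) (z : T.ω.obj Z) (s : Module.Dual k (T.ω.obj Z))
    (hu : ∀ v', u v' = T.unitFrom (T.ωmap e (T.tensorTo Z V (z ⊗ₜ v'))))
    (hs : ∀ z', s z' = T.unitFrom (T.ωmap e (T.tensorTo Z V (z' ⊗ₜ v)))) :
    T.coefAntipode hP (T.coef V hV v u) = T.coef Z hZ z s := by
  obtain ⟨h, hh⟩ := T.exists_hom_toDual e
  have h₁ : u = T.toDual V (T.ωmap h z) := by ext v'; rw [hu, hh]
  have h₂ : s = (T.toDual V).flip v ∘ₗ T.ωmap h := by ext z'; simp [hs, hh]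
  rw [h₁, coefAntipode_coef, h₂, T.coef_comp hZ (hP.dual hV)]

/-- The unitor pairs the unit object with itself. -/
theorem coefAntipode_one : T.coefAntipode hP (T.coefOne hP) = T.coefOne hP := by
  refine T.coefAntipode_pairing hP hP.unit hP.unit (λ_ _).hom _ _ _ _ (fun v => ?_) fun z => ?_
  · rw [ωmap_leftUnitor, one_smul]
  · conv_rhs => rw [← T.unitTo_unitFrom z]
    rw [ωmap_leftUnitor, map_smul, unitFrom_unitTo, smul_eq_mul, mul_one]

/-- The evaluation composed with the braiding pairs `V` with its dual, so `V` can stand in for its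
double dual. -/
theorem coefAntipode_antipode (a : T.CoefSpace P) :
    T.coefAntipode hP (T.coefAntipode hP a) = a := by
  induction a using T.coef_induction with
  | zero => simp
  | add a a' ha hb => simp [ha, hb]
  | coef V hV v u =>
  obtain ⟨ξ, rfl⟩ := (T.toDual_bijective V).2 u
  rw [coefAntipode_coef]
  refine T.coefAntipode_pairing hP hV (hP.dual hV)
    ((β_ _ _).hom ≫ ExactPairing.evaluation V (Vᘁ)) _ _ _ _ (fun η => ?_) fun z => ?_
  · rw [ωmap_comp_apply, ωmap_braiding, LinearMap.flip_apply, toDual_apply]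
  · rw [ωmap_comp_apply, ωmap_braiding, toDual_apply]

theorem ωmap_tensorμ (X₁ X₂ Y₁ Y₂ : C) (x₁ : T.ω.obj X₁) (x₂ : T.ω.obj X₂) (y₁ : T.ω.obj Y₁)
    (y₂ : T.ω.obj Y₂) :
    T.ωmap (tensorμ X₁ X₂ Y₁ Y₂) (T.tensorTo (X₁ ⊗ X₂) (Y₁ ⊗ Y₂)
        (T.tensorTo X₁ X₂ (x₁ ⊗ₜ x₂) ⊗ₜ T.tensorTo Y₁ Y₂ (y₁ ⊗ₜ y₂))) =
      T.tensorTo (X₁ ⊗ Y₁) (X₂ ⊗ Y₂)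
        (T.tensorTo X₁ Y₁ (x₁ ⊗ₜ y₁) ⊗ₜ T.tensorTo X₂ Y₂ (x₂ ⊗ₜ y₂)) := by
  simp only [tensorμ, ωmap_comp_apply, ωmap_associator, ωmap_whiskerLeft, ωmap_associator_inv,
    ωmap_whiskerRight, ωmap_braiding]

/-- The evaluation pairing of `V^* ⊗ W^*` with `V ⊗ W`. -/
def evalTensor (V W : C) : (Vᘁ ⊗ Wᘁ) ⊗ (V ⊗ W) ⟶ 𝟙_ C :=
  tensorμ (Vᘁ) (Wᘁ) V W ≫
    (ExactPairing.evaluation V (Vᘁ) ⊗ₘ ExactPairing.evaluation W (Wᘁ)) ≫ (λ_ _).hom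

theorem unitFrom_evalTensor (V W : C) (ξ : T.ω.obj (Vᘁ)) (η : T.ω.obj (Wᘁ)) (v : T.ω.obj V)
    (w : T.ω.obj W) :
    T.unitFrom (T.ωmap (evalTensor V W) (T.tensorTo (Vᘁ ⊗ Wᘁ) (V ⊗ W)
      (T.tensorTo (Vᘁ) (Wᘁ) (ξ ⊗ₜ η) ⊗ₜ T.tensorTo V W (v ⊗ₜ w)))) =
      T.toDual V ξ v * T.toDual W η w := by
  rw [evalTensor, ωmap_comp_apply, ωmap_comp_apply, ωmap_tensorμ, ωmap_tensorHom,
    ← T.unitTo_unitFrom (T.ωmap (ExactPairing.evaluation V (Vᘁ)) _), ωmap_leftUnitor, map_smul,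
    ← toDual_apply, ← toDual_apply, smul_eq_mul]

/-- The pairing `evalTensor` lets the tensor product of the duals replace the dual of `V ⊗ W`. -/
theorem coefAntipode_mul (a b : T.CoefSpace P) : T.coefAntipode hP (T.coefMul hP a b) =
    T.coefMul hP (T.coefAntipode hP a) (T.coefAntipode hP b) := by
  induction a using T.coef_induction with
  | zero => simp
  | add a a' ha hb => simp [ha, hb]
  | coef V hV v u =>
  induction b using T.coef_induction with
  | zero => simp
  | add a a' ha hb => simp [ha, hb]
  | coef W hW w t =>
  obtain ⟨ξ, rfl⟩ := (T.toDual_bijective V).2 u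
  obtain ⟨η, rfl⟩ := (T.toDual_bijective W).2 t
  rw [coefAntipode_coef, coefAntipode_coef, coefMul_coef, coefMul_coef]
  refine T.coefAntipode_pairing hP _ _ (evalTensor V W) _ _ _ _
    (LinearMap.congr_fun (g := (T.unitFrom ∘ₗ T.ωmap (evalTensor V W) ∘ₗ T.tensorTo _ _) ∘ₗ
      TensorProduct.mk k _ _ _) (T.tensor_hom_ext fun v w => ?_))
    (LinearMap.congr_fun (g := (T.unitFrom ∘ₗ T.ωmap (evalTensor V W) ∘ₗ T.tensorTo _ _) ∘ₗ
      (TensorProduct.mk k _ _).flip _) (T.tensor_hom_ext fun ξ η => ?_))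
  · simp [dualTensor_tensorTo, unitFrom_evalTensor]
  · simp [dualTensor_tensorTo, unitFrom_evalTensor]

/-- The sum collapses to one coefficient of `V^* ⊗ V` whose functional is the evaluation. The
relation for the evaluation morphism then moves it to the unit object. -/
theorem mul_coefAntipode_left (a : T.CoefSpace P) :
    TensorProduct.lift (T.coefMul hP)
      (TensorProduct.map (T.coefAntipode hP) LinearMap.id (T.coefComul P a)) =
      T.coefCounit P a • T.coefOne hP := by
  induction a using T.coef_induction with
  | zero => simp
  | add a a' ha hb => simp only [map_add, ha, hb, add_smul]
  | coef V hV v u =>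
  obtain ⟨ξ, rfl⟩ := (T.toDual_bijective V).2 u
  rw [T.coefComul_coef_basis P hV _ _ (Module.finBasis k (T.ω.obj V))]
  simp only [map_sum, TensorProduct.map_tmul, TensorProduct.lift.tmul, coefAntipode_coef,
    LinearMap.id_apply, coefMul_coef, coefCounit_coef]
  rw [← coef_sum_right]
  have h : T.unitFrom ∘ₗ T.ωmap (ExactPairing.evaluation V (Vᘁ)) =
      ∑ j, T.dualTensor ((T.toDual V).flip (Module.finBasis k (T.ω.obj V) j))
        ((Module.finBasis k (T.ω.obj V)).coord j) := T.tensor_hom_ext fun η x => by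
    simp only [LinearMap.comp_apply, LinearMap.sum_apply, dualTensor_tensorTo,
      LinearMap.flip_apply]
    rw [← toDual_apply]
    conv_lhs => rw [← sum_basis_coord (Module.finBasis k (T.ω.obj V)) x]
    simp only [map_sum, map_smul, smul_eq_mul, mul_comm]
  rw [← h, T.coef_comp _ hP.unit,
    ← T.unitTo_unitFrom (T.ωmap (ExactPairing.evaluation V (Vᘁ)) _), ← toDual_apply,
    coefOne, ← coef_smul_left, ← map_smul, smul_eq_mul, mul_one]

/-- Dually, the sum is one coefficient of `V ⊗ V^*` whose vector is the coevaluation, so it comes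
from the unit object. The remaining scalar is evaluated by a zigzag identity. -/
theorem mul_coefAntipode_right (a : T.CoefSpace P) :
    TensorProduct.lift (T.coefMul hP)
      (TensorProduct.map LinearMap.id (T.coefAntipode hP) (T.coefComul P a)) =
      T.coefCounit P a • T.coefOne hP := by
  induction a using T.coef_induction with
  | zero => simp
  | add a a' ha hb => simp only [map_add, ha, hb, add_smul]
  | coef V hV v u =>
  rw [T.coefComul_coef_basis P hV _ _ (Module.finBasis k (T.ω.obj V))]
  have hS : ∀ j, T.coefAntipode hP (T.coef V hV v ((Module.finBasis k (T.ω.obj V)).coord j)) =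
      T.coef (Vᘁ) (hP.dual hV) ((T.dualEquiv V).symm ((Module.finBasis k (T.ω.obj V)).coord j))
        ((T.toDual V).flip v) := fun j => by
    rw [← coefAntipode_coef, toDual_dualEquiv_symm]
  simp only [map_sum, TensorProduct.map_tmul, TensorProduct.lift.tmul, hS,
    LinearMap.id_apply, coefMul_coef, coefCounit_coef]
  rw [← coef_sum_left, ← map_sum, ← coev_eq_sum, tensorTo_coev, ← T.coef_comp hP.unit,
    coefOne, ← coef_smul_right]
  congr 1
  refine T.unit_hom_ext ?_
  rw [LinearMap.comp_apply, ← tensorTo_coev, LinearMap.smul_apply, unitFrom_unitTo]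
  conv_rhs => rw [← T.coev_left V v]
  generalize T.coev V = c
  induction c with
  | zero => simp
  | add a b ha hb => simp only [map_add, ha, hb, add_smul]
  | tmul x ξ => simp [dualTensor_tensorTo, mul_comm]

end Operations

/-! ### Prolongations on elements -/

theorem prolongEquiv_natural {X Y : C} (f : X ⟶ Y) (z : T.ω.obj (T.F.obj X)) :
    T.prolongEquiv Y (T.ωmap (T.F.map f) z) = Prolong.map (T.ωmap f) (T.prolongEquiv X z) :=
  LinearMap.congr_fun (congrArg (fun f => f.hom.hom) (T.comparison.hom.naturality f)) z

theorem prolongEquiv_oneElt {X : C} (v : T.ω.obj X) :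
    T.prolongEquiv X (T.oneElt X v) = Prolong.incl v :=
  (T.prolongEquiv X).apply_symm_apply _

theorem prolongEquiv_delElt {X : C} (v : T.ω.obj X) :
    T.prolongEquiv X (T.delElt X v) = Prolong.del v :=
  (T.prolongEquiv X).apply_symm_apply _

theorem ωmap_F_oneElt {X Y : C} (f : X ⟶ Y) (v : T.ω.obj X) :
    T.ωmap (T.F.map f) (T.oneElt X v) = T.oneElt Y (T.ωmap f v) := by
  apply (T.prolongEquiv Y).injective
  rw [prolongEquiv_natural, prolongEquiv_oneElt, prolongEquiv_oneElt]
  exact Prolong.ext' rfl (map_zero _)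

theorem ωmap_F_delElt {X Y : C} (f : X ⟶ Y) (v : T.ω.obj X) :
    T.ωmap (T.F.map f) (T.delElt X v) = T.delElt Y (T.ωmap f v) := by
  apply (T.prolongEquiv Y).injective
  rw [prolongEquiv_natural, prolongEquiv_delElt, prolongEquiv_delElt]
  exact Prolong.ext' (map_zero _) rfl

theorem delElt_add (X : C) (v w : T.ω.obj X) :
    T.delElt X (v + w) = T.delElt X v + T.delElt X w := by
  simp only [delElt, map_add]

theorem delElt_smul (X : C) (c : k) (v : T.ω.obj X) :
    T.delElt X (c • v) = c • T.delElt X v + c′ • T.oneElt X v := by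
  simp only [delElt, oneElt, Prolong.del_smul, map_add, map_smul]

theorem oneElt_sum_smul {X : C} {ι : Type*} (s : Finset ι) (c : ι → k) (x : ι → T.ω.obj X) :
    T.oneElt X (∑ j ∈ s, c j • x j) = ∑ j ∈ s, c j • T.oneElt X (x j) := by
  simp only [oneElt, map_sum, map_smul]

theorem delElt_sum_smul {X : C} {ι : Type*} (s : Finset ι) (c : ι → k) (x : ι → T.ω.obj X) :
    T.delElt X (∑ j ∈ s, c j • x j) =
      ∑ j ∈ s, (c j • T.delElt X (x j) + (c j)′ • T.oneElt X (x j)) := by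
  simp only [← delElt_smul]
  simp only [delElt, map_sum]

/-- Every element of `ω(X⁽¹⁾)` is of the form `1 ⊗ x + ∂ ⊗ y`. -/
theorem exists_oneElt_add_delElt {X : C} (z : T.ω.obj (T.F.obj X)) :
    ∃ x y, z = T.oneElt X x + T.delElt X y := by
  refine ⟨(T.prolongEquiv X z).1, (T.prolongEquiv X z).2, ?_⟩
  apply (T.prolongEquiv X).injective
  rw [map_add, prolongEquiv_oneElt, prolongEquiv_delElt]
  exact Prolong.ext' (add_zero _).symm (zero_add _).symm

theorem prolong_hom_ext {X : C} {M : Type*} [AddCommGroup M] [Module k M]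
    {f g : T.ω.obj (T.F.obj X) →ₗ[k] M} (h₁ : ∀ v, f (T.oneElt X v) = g (T.oneElt X v))
    (h₂ : ∀ v, f (T.delElt X v) = g (T.delElt X v)) : f = g := by
  ext z
  obtain ⟨x, y, rfl⟩ := T.exists_oneElt_add_delElt z
  rw [map_add, map_add, h₁, h₂]

/-- Although `v ↦ ∂ ⊗ v` is not linear, `∂ ⊗ cv = c(∂ ⊗ v) + c′(1 ⊗ v)` keeps the span of the `1 ⊗
b_j` and `∂ ⊗ b_j` equal to the whole space. -/
theorem prolong_hom_ext_basis {X : C} {ι : Type*} [Fintype ι]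
    (b : Module.Basis ι k (T.ω.obj X)) {M : Type*} [AddCommGroup M] [Module k M]
    {f g : T.ω.obj (T.F.obj X) →ₗ[k] M} (h₁ : ∀ j, f (T.oneElt X (b j)) = g (T.oneElt X (b j)))
    (h₂ : ∀ j, f (T.delElt X (b j)) = g (T.delElt X (b j))) : f = g := by
  refine T.prolong_hom_ext (fun v => ?_) (fun v => ?_)
  · rw [← sum_basis_coord b v, oneElt_sum_smul]
    simp only [map_sum, map_smul, h₁]
  · rw [← sum_basis_coord b v, delElt_sum_smul]
    simp only [map_sum, map_add, map_smul, h₁, h₂]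

theorem extendDual_oneElt {X : C} (u : Module.Dual k (T.ω.obj X)) (v : T.ω.obj X) :
    T.extendDual X u (T.oneElt X v) = u v := by
  change u (T.prolongEquiv X (T.oneElt X v)).1 +
    Differential.deriv (u (T.prolongEquiv X (T.oneElt X v)).2) = u v
  rw [prolongEquiv_oneElt]
  change u v + Differential.deriv (u 0) = u v
  simp

theorem extendDual_delElt {X : C} (u : Module.Dual k (T.ω.obj X)) (v : T.ω.obj X) :
    T.extendDual X u (T.delElt X v) = Differential.deriv (u v) := by
  change u (T.prolongEquiv X (T.delElt X v)).1 +
    Differential.deriv (u (T.prolongEquiv X (T.delElt X v)).2) = _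
  rw [prolongEquiv_delElt]
  change u 0 + Differential.deriv (u v) = Differential.deriv (u v)
  simp

theorem extendDual_add (X : C) (u t : Module.Dual k (T.ω.obj X)) :
    T.extendDual X (u + t) = T.extendDual X u + T.extendDual X t :=
  T.prolong_hom_ext (fun v => by simp [extendDual_oneElt])
    (fun v => by simp [extendDual_delElt])

theorem extendDual_comp {X Y : C} (f : X ⟶ Y) (u : Module.Dual k (T.ω.obj Y)) :
    T.extendDual X (u ∘ₗ T.ωmap f) = T.extendDual Y u ∘ₗ T.ωmap (T.F.map f) :=
  T.prolong_hom_ext (fun v => by simp [extendDual_oneElt, ωmap_F_oneElt])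
    (fun v => by simp [extendDual_delElt, ωmap_F_delElt])

/-! ### Direct limits -/

open scoped Classical in
/-- The space of matrix coefficients commutes with directed unions of full subcategories. -/
theorem isDirectLimit_coefSpace {ι : Type*} [Preorder ι] [Nonempty ι] [IsDirectedOrder ι]
    (P : ι → ObjectProperty C) (hP : ∀ i j, i ≤ j → P i ≤ P j) (Q : ObjectProperty C)
    (hQ : ∀ i, P i ≤ Q) (hcov : ∀ V, Q V → ∃ i, P i V) :
    IsDirectLimit (fun i => T.CoefSpace (P i)) (fun i j h => T.coefMap (hP i j h))
      (T.CoefSpace Q) (fun i => T.coefMap (hQ i)) := by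
  have hcomp : ∀ i j (hij : i ≤ j) (x : T.CoefSpace (P i)),
      T.coefMap (hQ j) (T.coefMap (hP i j hij) x) = T.coefMap (hQ i) x := fun i j hij =>
    LinearMap.congr_fun (f := T.coefMap (hQ j) ∘ₗ T.coefMap (hP i j hij))
      (T.coef_hom_ext fun V hV v u => by simp only [LinearMap.comp_apply, coefMap_coef])
  refine ⟨inferInstance, inferInstance, ⟨fun i => ?_, fun l j i hij hjk => ?_⟩, hcomp, ?_, ?_⟩
  · exact LinearMap.congr_fun (g := LinearMap.id)
      (T.coef_hom_ext fun V hV v u => by simp only [LinearMap.id_apply, coefMap_coef])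
  · exact LinearMap.congr_fun (f := T.coefMap (hP _ _ hjk) ∘ₗ T.coefMap (hP _ _ hij))
      (T.coef_hom_ext fun V hV v u => by simp only [LinearMap.comp_apply, coefMap_coef])
  · let M := Module.DirectLimit (fun i => T.CoefSpace (P i)) (fun i j h => T.coefMap (hP i j h))
    let of : ∀ i, T.CoefSpace (P i) →ₗ[k] M := fun i =>
      Module.DirectLimit.of k ι (fun i => T.CoefSpace (P i)) (fun i j h => T.coefMap (hP i j h)) i
    have hof : ∀ i j (h : i ≤ j) V (hV : P i V) v u,
        of j (T.coef V (hP i j h V hV) v u) = of i (T.coef V hV v u) := fun i j h V hV v u => by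
      rw [← T.coefMap_coef (hP i j h)]
      exact Module.DirectLimit.of_f (hij := h)
    choose idx hidx using hcov
    have hof' : ∀ {V W} i j (hV : P i V) (hW : P j W) (f : V ⟶ W) v u,
        of i (T.coef V hV v (u ∘ₗ T.ωmap f)) = of j (T.coef W hW (T.ωmap f v) u) := by
      intro V W i j hV hW f v u
      obtain ⟨l, hil, hjl⟩ := exists_ge_ge i j
      -- In a common upper bound `l` both objects are present, hence by fullness so is `f`, and its
      -- relation already holds there.
      rw [← hof i l hil, ← hof j l hjl, T.coef_comp _ (hP j l hjl W hW)]
    let inv : T.CoefSpace Q →ₗ[k] M := T.coefLift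
      (fun V hV => (T.coefBilin (hidx V hV)).compr₂ (of (idx V hV)))
      fun V W hV hW f v u => hof' _ _ _ _ f v u
    have hinv : ∀ i V (hV : P i V) v u,
        inv (T.coef V (hQ i V hV) v u) = of i (T.coef V hV v u) := fun i V hV v u => by
      refine (T.coefLift_coef _ _ (hQ i V hV) v u).trans ?_
      simpa [ωmap_id, coefBilin_apply] using hof' (idx V (hQ i V hV)) i (hidx V _) hV (𝟙 V) v u
    -- Sending a coefficient of `V` to its class at any index containing `V` is a left inverse;
    -- `hof'` makes the choice of index harmless.
    refine Function.LeftInverse.injective (g := inv) fun x => ?_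
    refine LinearMap.congr_fun (f := inv ∘ₗ Module.DirectLimit.lift k ι _ _ _ hcomp)
      (g := LinearMap.id) (Module.DirectLimit.hom_ext fun i => T.coef_hom_ext fun V hV v u => ?_) x
    simp only [LinearMap.comp_apply, Module.DirectLimit.lift_of, LinearMap.id_apply, coefMap_coef]
    exact hinv i V hV v u
  · intro a
    induction a using T.coef_induction with
    | zero => exact ⟨0, map_zero _⟩
    | add a b ha hb =>
      obtain ⟨x, rfl⟩ := ha
      obtain ⟨y, rfl⟩ := hb
      exact ⟨x + y, map_add _ _ _⟩
    | coef V hV v u =>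
      obtain ⟨i, hi⟩ := hcov V hV
      refine ⟨Module.DirectLimit.of k ι _ _ i (T.coef V hi v u), ?_⟩
      rw [Module.DirectLimit.lift_of, coefMap_coef]

theorem diffGen_le {X Y : C} (h : T.diffGen Y X) : T.diffGen X ≤ T.diffGen Y := by
  intro Z hZ
  induction hZ with
  | self => exact h
  | unit => exact .unit
  | biprod _ _ h₁ h₂ => exact .biprod h₁ h₂
  | sub f _ h => exact .sub f h
  | quot f _ h => exact .quot f h
  | tensor _ _ h₁ h₂ => exact .tensor h₁ h₂
  | dual _ h => exact .dual h
  | prolong _ h => exact .prolong h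

theorem abGen_le {X Y : C} (h : abGen Y X) : abGen X ≤ abGen Y := by
  intro Z hZ
  induction hZ with
  | self => exact h
  | biprod _ _ h₁ h₂ => exact .biprod h₁ h₂
  | sub f _ h => exact .sub f h
  | quot f _ h => exact .quot f h

instance : Nonempty T.DiffIndex := ⟨⟨𝟙_ C⟩⟩

/-- Both objects are subobjects of their biproduct, which therefore generates an upper bound. -/
instance : IsDirectedOrder T.DiffIndex where
  directed X Y := ⟨⟨X.obj ⊞ Y.obj⟩,
    T.diffGen_le (.sub (Limits.biprod.inl : X.obj ⟶ X.obj ⊞ Y.obj) .self),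
    T.diffGen_le (.sub (Limits.biprod.inr : Y.obj ⟶ X.obj ⊞ Y.obj) .self)⟩

instance (X : C) : Nonempty (T.AbIndex X) := ⟨⟨X, .self⟩⟩

instance (X : C) : IsDirectedOrder (T.AbIndex X) where
  directed Y Z := ⟨⟨Y.1 ⊞ Z.1, .biprod Y.2 Z.2⟩,
    abGen_le (.sub (Limits.biprod.inl : Y.1 ⟶ Y.1 ⊞ Z.1) .self),
    abGen_le (.sub (Limits.biprod.inr : Z.1 ⟶ Y.1 ⊞ Z.1) .self)⟩

/-! ### Spanning by matrix coefficients -/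

section Span

variable {T} {P : ObjectProperty C} (N : Submodule k (T.CoefSpace P)) {V W : C} (hV : P V)
  (hW : P W)

theorem coef_mem_of_basis {n : ℕ} (b : Module.Basis (Fin n) k (T.ω.obj V))
    (h : ∀ i j, T.coef V hV (b i) (b.coord j) ∈ N) (v : T.ω.obj V)
    (u : Module.Dual k (T.ω.obj V)) : T.coef V hV v u ∈ N := by
  rw [← sum_basis_coord b v, ← b.sum_dual_apply_smul_coord u, coef_sum_left]
  refine N.sum_mem fun i _ => ?_
  rw [coef_sum_right]
  refine N.sum_mem fun j _ => ?_
  rw [coef_smul_left, coef_smul_right]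
  exact N.smul_mem _ (N.smul_mem _ (h i j))

theorem coef_mem_of_biprod (hVW : P (V ⊞ W)) (h₁ : ∀ v u, T.coef V hV v u ∈ N)
    (h₂ : ∀ v u, T.coef W hW v u ∈ N) (v : T.ω.obj (V ⊞ W))
    (u : Module.Dual k (T.ω.obj (V ⊞ W))) : T.coef (V ⊞ W) hVW v u ∈ N := by
  have h : v = T.ωmap Limits.biprod.inl (T.ωmap Limits.biprod.fst v) +
      T.ωmap Limits.biprod.inr (T.ωmap Limits.biprod.snd v) := by
    rw [← ωmap_comp_apply, ← ωmap_comp_apply, ← LinearMap.add_apply, ← ωmap_add,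
      Limits.biprod.total, ωmap_id, LinearMap.id_apply]
  rw [h, coef_add_left, ← T.coef_comp hV hVW, ← T.coef_comp hW hVW]
  exact N.add_mem (h₁ _ _) (h₂ _ _)

/-- Functionals on a subspace extend, so coefficients of a subobject are coefficients of the ambient
object. -/
theorem coef_mem_of_mono (f : V ⟶ W) [Mono f] (h : ∀ v u, T.coef W hW v u ∈ N) (v : T.ω.obj V)
    (u : Module.Dual k (T.ω.obj V)) : T.coef V hV v u ∈ N := by
  obtain ⟨u, rfl⟩ := LinearMap.dualMap_surjective_of_injective (T.ωmap_injective f) u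
  rw [LinearMap.dualMap_apply', T.coef_comp hV hW]
  exact h _ _

theorem coef_mem_of_epi (f : V ⟶ W) [Epi f] (h : ∀ v u, T.coef V hV v u ∈ N) (v : T.ω.obj W)
    (u : Module.Dual k (T.ω.obj W)) : T.coef W hW v u ∈ N := by
  obtain ⟨v, rfl⟩ := T.ωmap_surjective f v
  rw [← T.coef_comp hV hW]
  exact h _ _

theorem coef_mem_of_unit (hP : T.IsDiffTensorClosed P) (h : T.coefOne hP ∈ N)
    (v : T.ω.obj (𝟙_ C)) (u : Module.Dual k (T.ω.obj (𝟙_ C))) :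
    T.coef (𝟙_ C) hP.unit v u ∈ N := by
  have hu : u = u (T.unitTo 1) • T.unitFrom := T.unit_hom_ext (by simp [unitFrom_unitTo])
  have hv : v = T.unitFrom v • T.unitTo 1 := by
    rw [← map_smul, smul_eq_mul, mul_one, unitTo_unitFrom]
  rw [hu, hv, coef_smul_left, coef_smul_right]
  exact N.smul_mem _ (N.smul_mem _ h)

theorem coef_mem_of_tensor (hP : T.IsDiffTensorClosed P)
    (hN : ∀ a ∈ N, ∀ b ∈ N, T.coefMul hP a b ∈ N) (h₁ : ∀ v u, T.coef V hV v u ∈ N)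
    (h₂ : ∀ v u, T.coef W hW v u ∈ N) (z : T.ω.obj (V ⊗ W))
    (s : Module.Dual k (T.ω.obj (V ⊗ W))) :
    T.coef (V ⊗ W) (hP.tensor hV hW) z s ∈ N := by
  have hs : s = ∑ i : Fin _ × Fin _, s (T.tensorTo V W
      (Module.finBasis k (T.ω.obj V) i.1 ⊗ₜ Module.finBasis k (T.ω.obj W) i.2)) •
        T.dualTensor ((Module.finBasis k (T.ω.obj V)).coord i.1)
          ((Module.finBasis k (T.ω.obj W)).coord i.2) := by
    ext y
    conv_lhs => rw [← T.sum_dualTensor_smul_tensorTo _ _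
      (sum_basis_coord (Module.finBasis k (T.ω.obj V))) _ _
      (sum_basis_coord (Module.finBasis k (T.ω.obj W))) y]
    simp [mul_comm]
  rw [hs, coef_sum_right]
  refine N.sum_mem fun i _ => ?_
  rw [coef_smul_right]
  refine N.smul_mem _ ?_
  obtain ⟨x, rfl⟩ : ∃ x, T.tensorTo V W x = z := ⟨_, T.tensorTo_tensorFrom z⟩
  induction x with
  | zero => simpa only [map_zero, ← coefBilin_apply, LinearMap.zero_apply] using N.zero_mem
  | add x y hx hy => rw [map_add, coef_add_left]; exact N.add_mem hx hy
  | tmul v w => rw [← T.coefMul_coef hP hV hW]; exact hN _ (h₁ _ _) _ (h₂ _ _)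

theorem coef_mem_of_dual (hP : T.IsDiffTensorClosed P) (hN : ∀ a ∈ N, T.coefAntipode hP a ∈ N)
    (h : ∀ v u, T.coef V hV v u ∈ N) (ξ : T.ω.obj (Vᘁ)) (s : Module.Dual k (T.ω.obj (Vᘁ))) :
    T.coef (Vᘁ) (hP.dual hV) ξ s ∈ N := by
  obtain ⟨v, rfl⟩ : ∃ v, (T.toDual V).flip v = s := by
    -- By reflexivity of `ω(V)`, every functional on its dual is evaluation at a vector.
    obtain ⟨v, hv⟩ := (Module.evalEquiv k (T.ω.obj V)).surjective
      (s ∘ₗ (T.dualEquiv V).symm.toLinearMap)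
    refine ⟨v, LinearMap.ext fun ξ => ?_⟩
    have := LinearMap.congr_fun hv (T.toDual V ξ)
    simpa [dualEquiv_symm_toDual] using this
  rw [← T.coefAntipode_coef hP hV]
  exact hN _ (h _ _)

end Span

end FiberData

/-! ### The derivation and its compatibility with the Hopf operations -/

namespace NeutralDiffTannakian

variable [MonoidalPreadditive C] [MonoidalLinear k C] (T : NeutralDiffTannakian k C)

theorem ωmap_i {X : C} (v : T.ω.obj X) : T.ωmap (T.i X) v = T.oneElt X v := by
  apply (T.prolongEquiv X).injective
  rw [T.ω_i, T.prolongEquiv_oneElt]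

theorem ωmap_φ_oneElt {X : C} (v : T.ω.obj X) : T.ωmap (T.φ X) (T.oneElt X v) = 0 := by
  rw [T.ω_φ, T.prolongEquiv_oneElt]; rfl

theorem ωmap_φ_delElt {X : C} (v : T.ω.obj X) : T.ωmap (T.φ X) (T.delElt X v) = v := by
  rw [T.ω_φ, T.prolongEquiv_delElt]; rfl

/-- The correction term factors through `φ`, so in a coefficient against `∂ ⊗ v` it contributes `c′
a_X(v ⊗ u)`, just as the Leibniz rule requires. -/
theorem extendDual_smul (X : C) (c : k) (u : Module.Dual k (T.ω.obj X)) :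
    T.extendDual X (c • u) = c • T.extendDual X u + c′ • (u ∘ₗ T.ωmap (T.φ X)) :=
  T.prolong_hom_ext
    (fun v => by simp [T.extendDual_oneElt, ωmap_φ_oneElt])
    (fun v => by simp [T.extendDual_delElt, ωmap_φ_delElt, mul_comm])

theorem extendDual_comp_i (X : C) (u : Module.Dual k (T.ω.obj X)) :
    T.extendDual X u ∘ₗ T.ωmap (T.i X) = u := by
  ext v
  simp [ωmap_i, T.extendDual_oneElt]

/-- The functionals `F(b_j^*)` and `φ^*(b_j^*)` are dual to the vectors `1 ⊗ b_j` and `∂ ⊗ b_j`. -/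
theorem sum_prolong_basis {V : C} {n : ℕ} (b : Module.Basis (Fin n) k (T.ω.obj V)) :
    ∑ j, (T.extendDual V (b.coord j)).smulRight (T.oneElt V (b j)) +
      ∑ j, (b.coord j ∘ₗ T.ωmap (T.φ V)).smulRight (T.delElt V (b j)) = LinearMap.id := by
  refine T.prolong_hom_ext_basis b (fun l => ?_) (fun l => ?_)
  · simp [T.extendDual_oneElt, ωmap_φ_oneElt, Finsupp.single_apply, ite_smul]
  · simp [T.extendDual_delElt, ωmap_φ_delElt, Finsupp.single_apply, ite_smul, apply_ite]

section Operations

variable {P : ObjectProperty C} (hP : T.IsDiffTensorClosed P)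

theorem coef_oneElt {V : C} (hV : P V) (v : T.ω.obj V)
    (s : Module.Dual k (T.ω.obj (T.F.obj V))) :
    T.coef (T.F.obj V) (hP.prolong hV) (T.oneElt V v) s =
      T.coef V hV v (s ∘ₗ T.ωmap (T.i V)) := by
  rw [T.coef_comp hV (hP.prolong hV), ωmap_i]

theorem coef_comp_φ {V : C} (hV : P V) (z : T.ω.obj (T.F.obj V))
    (u : Module.Dual k (T.ω.obj V)) :
    T.coef (T.F.obj V) (hP.prolong hV) z (u ∘ₗ T.ωmap (T.φ V)) =
      T.coef V hV (T.ωmap (T.φ V) z) u :=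
  T.coef_comp _ _ _ _ _

/-- The bilinear map `(v, u) ↦ (-∂(a_V(v ⊗ u)), a_V(v ⊗ u))`. -/
def coefProlongBilin {V : C} (hV : P V) :
    T.ω.obj V →ₗ[k] Module.Dual k (T.ω.obj V) →ₗ[k] Prolong k (T.CoefSpace P) :=
  LinearMap.mk₂ k
    (fun v u => Prolong.mk
      (-T.coef (T.F.obj V) (hP.prolong hV) (T.delElt V v) (T.extendDual V u)) (T.coef V hV v u))
    (fun v v' u => Prolong.ext'
      (by simp only [Prolong.mk_fst, Prolong.add_fst, T.delElt_add, FiberData.coef_add_left,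
        neg_add])
      (by simp only [Prolong.mk_snd, Prolong.add_snd, FiberData.coef_add_left]))
    (fun c v u => Prolong.ext'
      (by
        simp only [Prolong.mk_fst, Prolong.mk_snd, Prolong.smul_fst, T.delElt_smul,
          FiberData.coef_add_left, FiberData.coef_smul_left, T.coef_oneElt hP hV,
          extendDual_comp_i]
        module)
      (by simp only [Prolong.mk_snd, Prolong.smul_snd, FiberData.coef_smul_left]))
    (fun v u u' => Prolong.ext'
      (by simp only [Prolong.mk_fst, Prolong.add_fst, T.extendDual_add, FiberData.coef_add_right,
        neg_add])
      (by simp only [Prolong.mk_snd, Prolong.add_snd, FiberData.coef_add_right]))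
    (fun c v u => Prolong.ext'
      (by
        simp only [Prolong.mk_fst, Prolong.mk_snd, Prolong.smul_fst, T.extendDual_smul,
          FiberData.coef_add_right, FiberData.coef_smul_right, T.coef_comp_φ hP hV,
          ωmap_φ_delElt]
        module)
      (by simp only [Prolong.mk_snd, Prolong.smul_snd, FiberData.coef_smul_right]))

theorem coefProlongBilin_apply {V : C} (hV : P V) (v : T.ω.obj V)
    (u : Module.Dual k (T.ω.obj V)) :
    T.coefProlongBilin hP hV v u = Prolong.mk
      (-T.coef (T.F.obj V) (hP.prolong hV) (T.delElt V v) (T.extendDual V u))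
      (T.coef V hV v u) := rfl

/-- The linear map `a ↦ (-∂ a, a)`, which encodes the derivation. -/
def coefProlong : T.CoefSpace P →ₗ[k] Prolong k (T.CoefSpace P) :=
  T.coefLift (fun V hV => T.coefProlongBilin hP hV) fun V W hV hW f v u => by
    rw [coefProlongBilin_apply, coefProlongBilin_apply, T.extendDual_comp,
      T.coef_comp _ (hP.prolong hW), T.ωmap_F_delElt, T.coef_comp hV hW]

theorem coefProlong_coef {V : C} (hV : P V) (v : T.ω.obj V) (u : Module.Dual k (T.ω.obj V)) :
    T.coefProlong hP (T.coef V hV v u) = Prolong.mk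
      (-T.coef (T.F.obj V) (hP.prolong hV) (T.delElt V v) (T.extendDual V u))
      (T.coef V hV v u) := by
  rw [coefProlong, T.coefLift_coef, coefProlongBilin_apply]

theorem coefProlong_snd (a : T.CoefSpace P) : (T.coefProlong hP a).2 = a := by
  refine LinearMap.congr_fun (f := Prolong.proj ∘ₗ T.coefProlong hP) (g := LinearMap.id)
    (T.coef_hom_ext fun V hV v u => ?_) a
  rw [LinearMap.comp_apply, coefProlong_coef]
  rfl

/-- The derivation on matrix coefficients. -/
def coefDeriv : T.CoefSpace P →+ T.CoefSpace P :=
  AddMonoidHom.mk' (fun a => -(T.coefProlong hP a).1) fun a b => by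
    rw [map_add, Prolong.add_fst, neg_add]

theorem coefDeriv_apply (a : T.CoefSpace P) : T.coefDeriv hP a = -(T.coefProlong hP a).1 := rfl

theorem coefDeriv_coef {V : C} (hV : P V) (v : T.ω.obj V) (u : Module.Dual k (T.ω.obj V)) :
    T.coefDeriv hP (T.coef V hV v u) =
      T.coef (T.F.obj V) (hP.prolong hV) (T.delElt V v) (T.extendDual V u) := by
  rw [coefDeriv_apply, coefProlong_coef, Prolong.mk_fst, neg_neg]

theorem coefDeriv_smul (c : k) (a : T.CoefSpace P) :
    T.coefDeriv hP (c • a) = c′ • a + c • T.coefDeriv hP a := by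
  rw [coefDeriv_apply, coefDeriv_apply, map_smul, Prolong.smul_fst, coefProlong_snd]
  module

/-- Through `i`, an underived factor `a_V(v ⊗ u)` is the coefficient of `1 ⊗ v` against `F(u)`. Both
sides then become coefficients of `V⁽¹⁾ ⊗ W⁽¹⁾`, related by the morphism `τ` of the product axiom.
-/
theorem coefDeriv_mul (a b : T.CoefSpace P) : T.coefDeriv hP (T.coefMul hP a b) =
    T.coefMul hP (T.coefDeriv hP a) b + T.coefMul hP a (T.coefDeriv hP b) := by
  induction a using T.coef_induction with
  | zero => simp
  | add a a' ha hb => simp only [map_add, LinearMap.add_apply, ha, hb]; abel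
  | coef V hV v u =>
  induction b using T.coef_induction with
  | zero => simp
  | add a a' ha hb => simp only [map_add, ha, hb]; abel
  | coef W hW w t =>
  obtain ⟨τ, hτ⟩ := T.product_rule V W
  have hF : T.extendDual (V ⊗ W) (T.dualTensor u t) =
      T.dualTensor (T.extendDual V u) (T.extendDual W t) ∘ₗ T.ωmap τ := by
    refine T.prolong_hom_ext (fun z => ?_) (fun z => ?_)
    all_goals
      obtain ⟨x, rfl⟩ : ∃ x, T.tensorTo V W x = z := ⟨_, T.tensorTo_tensorFrom z⟩
      induction x with
      | zero => simp [FiberData.oneElt, FiberData.delElt]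
      | add x y hx hy =>
        simp only [FiberData.oneElt, FiberData.delElt, map_add] at hx hy ⊢
        rw [hx, hy]
      | tmul v w => ?_
    · rw [LinearMap.comp_apply, (hτ v w).1]
      simp only [T.extendDual_oneElt, T.dualTensor_tensorTo]
    · rw [LinearMap.comp_apply, (hτ v w).2, map_add, map_add]
      simp only [T.extendDual_oneElt, T.extendDual_delElt, T.dualTensor_tensorTo,
        Derivation.leibniz, smul_eq_mul]
      ring
  have h₁ : T.coef V hV v u =
      T.coef (T.F.obj V) (hP.prolong hV) (T.oneElt V v) (T.extendDual V u) := by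
    rw [T.coef_oneElt hP hV, extendDual_comp_i]
  have h₂ : T.coef W hW w t =
      T.coef (T.F.obj W) (hP.prolong hW) (T.oneElt W w) (T.extendDual W t) := by
    rw [T.coef_oneElt hP hW, extendDual_comp_i]
  rw [T.coefMul_coef, coefDeriv_coef, coefDeriv_coef, coefDeriv_coef, h₁, h₂, T.coefMul_coef,
    T.coefMul_coef, hF, T.coef_comp _ (hP.tensor (hP.prolong hV) (hP.prolong hW)), (hτ v w).2,
    map_add, FiberData.coef_add_left]

/-- In the resolution of `sum_prolong_basis`, the terms with `1 ⊗ b_j` and `F(b_j^*)` derive the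
right tensor factor, and those with `∂ ⊗ b_j` and `φ^*(b_j^*)` derive the left one. -/
theorem coefComul_deriv (a : T.CoefSpace P) : T.coefComul P (T.coefDeriv hP a) =
    tensorDeriv (T.coefDeriv hP) (T.coefDeriv_smul hP) (T.coefComul P a) := by
  induction a using T.coef_induction with
  | zero => simp
  | add a a' ha hb => simp only [map_add, ha, hb]
  | coef V hV v u =>
  set b := Module.finBasis k (T.ω.obj V)
  have hd : ∀ x y : T.CoefSpace P,
      tensorDeriv (T.coefDeriv hP) (T.coefDeriv_smul hP) (x ⊗ₜ y) =
        T.coefDeriv hP x ⊗ₜ[k] y + x ⊗ₜ[k] T.coefDeriv hP y := fun _ _ => rfl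
  have hres : ∀ z, ∑ s : Fin _ ⊕ Fin _,
      Sum.elim (fun j => T.extendDual V (b.coord j)) (fun j => b.coord j ∘ₗ T.ωmap (T.φ V)) s z •
        Sum.elim (fun j => T.oneElt V (b j)) (fun j => T.delElt V (b j)) s = z := fun z => by
    simpa using LinearMap.congr_fun (T.sum_prolong_basis b) z
  rw [coefDeriv_coef, T.coefComul_coef P _ _ _ _ _ hres, T.coefComul_coef_basis P hV _ _ b]
  simp only [Fintype.sum_sum_type, Sum.elim_inl, Sum.elim_inr, map_sum, hd, coefDeriv_coef,
    T.coef_oneElt hP hV, T.coef_comp_φ hP hV, extendDual_comp_i, ωmap_φ_delElt,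
    Finset.sum_add_distrib]
  exact add_comm _ _

theorem coefCounit_deriv (a : T.CoefSpace P) :
    T.coefCounit P (T.coefDeriv hP a) = Differential.deriv (T.coefCounit P a) := by
  induction a using T.coef_induction with
  | zero => simp
  | add a a' ha hb => simp only [map_add, ha, hb]
  | coef V hV v u =>
  rw [coefDeriv_coef, T.coefCounit_coef, T.coefCounit_coef, T.extendDual_delElt]

/-- The morphism `g : (X^*)⁽¹⁾ ⟶ (X⁽¹⁾)^*` is given by `1 ⊗ ξ ↦ φ^*(ξ)` and `∂ ⊗ ξ ↦ F(ξ)`. -/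
theorem exists_dual_prolong (X : C) : ∃ g : T.F.obj (Xᘁ) ⟶ (T.F.obj X)ᘁ,
    ∀ ξ, T.toDual _ (T.ωmap g (T.oneElt _ ξ)) = T.toDual X ξ ∘ₗ T.ωmap (T.φ X) ∧
      T.toDual _ (T.ωmap g (T.delElt _ ξ)) = T.extendDual X (T.toDual X ξ) := by
  obtain ⟨g, hi, hφ, n, b, b', hb, hg⟩ := T.dual_rule X
  have h₁ : ∀ ξ, T.toDual _ (T.ωmap g (T.oneElt _ ξ)) = T.toDual X ξ ∘ₗ T.ωmap (T.φ X) :=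
    fun ξ => by rw [← ωmap_i, ← T.ωmap_comp_apply, hi, T.toDual_rightAdjointMate]
  have h₂ : ∀ ξ, T.toDual _ (T.ωmap g (T.delElt _ ξ)) ∘ₗ T.ωmap (T.i X) = T.toDual X ξ :=
    fun ξ => by rw [← T.toDual_rightAdjointMate, ← T.ωmap_comp_apply, hφ, ωmap_φ_delElt]
  -- On `1 ⊗ b_l` the functionals agree by compatibility with `i`. On `∂ ⊗ b_l` both vanish: one by
  -- the splitting condition, the other because the pairings are `0` or `1` and have derivative
  -- zero.
  have h₃ : ∀ j, T.toDual _ (T.ωmap g (T.delElt _ (b' j))) = T.extendDual X (T.toDual X (b' j)) :=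
    fun j => T.prolong_hom_ext_basis b
      (fun l => by
        rw [T.extendDual_oneElt, ← h₂ (b' j), LinearMap.comp_apply, ωmap_i])
      (fun l => by
        rw [hg, T.extendDual_delElt, hb]
        split_ifs <;> simp)
  refine ⟨g, fun ξ => ⟨h₁ ξ, ?_⟩⟩
  obtain ⟨c, rfl⟩ : ∃ c : Fin n → k, ξ = ∑ j, c j • b' j :=
    ⟨fun j => T.toDual X ξ (b j), (T.toDual_bijective X).1 <| b.ext fun l => by simp [hb]⟩
  -- Neither side is linear in `ξ`, but both obey the same twisted rule for scalars, so agreement on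
  -- the dual basis suffices.
  have hsum : ∀ s : Finset (Fin n), T.extendDual X (T.toDual X (∑ j ∈ s, c j • b' j)) =
      ∑ j ∈ s, (c j • T.extendDual X (T.toDual X (b' j)) +
        (c j)′ • (T.toDual X (b' j) ∘ₗ T.ωmap (T.φ X))) := fun s => by
    classical
    induction s using Finset.induction_on with
    | empty =>
      exact T.prolong_hom_ext (by simp [T.extendDual_oneElt]) (by simp [T.extendDual_delElt])
    | insert j s hj ih =>
      rw [Finset.sum_insert hj, Finset.sum_insert hj, map_add, map_smul, T.extendDual_add, ih,
        extendDual_smul]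
  rw [hsum, T.delElt_sum_smul]
  simp only [map_sum, map_add, map_smul, h₁, h₃]

/-- The two sides are coefficients of `(V⁽¹⁾)^*` and `(V^*)⁽¹⁾`, matched by the coefficient relation
for `g`. -/
theorem coefAntipode_deriv (a : T.CoefSpace P) :
    T.coefAntipode hP (T.coefDeriv hP a) = T.coefDeriv hP (T.coefAntipode hP a) := by
  induction a using T.coef_induction with
  | zero => simp
  | add a a' ha hb => simp only [map_add, ha, hb]
  | coef V hV v u =>
  obtain ⟨ξ, rfl⟩ := (T.toDual_bijective V).2 u
  obtain ⟨g, hg⟩ := T.exists_dual_prolong V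
  rw [coefDeriv_coef, ← (hg ξ).2, T.coefAntipode_coef, T.coefAntipode_coef, coefDeriv_coef,
    ← T.coef_comp (hP.prolong (hP.dual hV))]
  congr 1
  refine T.prolong_hom_ext (fun η => ?_) (fun η => ?_)
  · rw [LinearMap.comp_apply, LinearMap.flip_apply, (hg η).1, T.extendDual_oneElt]
    simp [ωmap_φ_delElt]
  · rw [LinearMap.comp_apply, LinearMap.flip_apply, (hg η).2, T.extendDual_delElt,
      T.extendDual_delElt, LinearMap.flip_apply]

end Operations

variable {T} in
-- Coefficients of `1 ⊗ x` come from `V` through `i`. Against `∂ ⊗ y`, the functionals `F(b_j^*)`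
-- give derivatives of coefficients of `V`, and those factoring through `φ` give coefficients of
-- `V`; together they span the dual.
theorem coef_mem_of_prolong {P : ObjectProperty C} (N : Submodule k (T.CoefSpace P)) {V : C}
    (hV : P V) (hP : T.IsDiffTensorClosed P) (hN : ∀ a ∈ N, T.coefDeriv hP a ∈ N)
    (h : ∀ v u, T.coef V hV v u ∈ N) (z : T.ω.obj (T.F.obj V))
    (s : Module.Dual k (T.ω.obj (T.F.obj V))) :
    T.coef (T.F.obj V) (hP.prolong hV) z s ∈ N := by
  obtain ⟨x, y, rfl⟩ := T.exists_oneElt_add_delElt z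
  set b := Module.finBasis k (T.ω.obj V)
  have hs : s = ∑ j, s (T.oneElt V (b j)) • T.extendDual V (b.coord j) +
      ∑ j, s (T.delElt V (b j)) • (b.coord j ∘ₗ T.ωmap (T.φ V)) := by
    ext y
    conv_lhs => rw [← LinearMap.id_apply (R := k) y, ← T.sum_prolong_basis b]
    simp [mul_comm]
  rw [FiberData.coef_add_left, T.coef_oneElt hP hV]
  refine N.add_mem (h _ _) ?_
  rw [hs, FiberData.coef_add_right, FiberData.coef_sum_right, FiberData.coef_sum_right]
  refine N.add_mem (N.sum_mem fun j _ => ?_) (N.sum_mem fun j _ => ?_)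
  · rw [FiberData.coef_smul_right, ← T.coefDeriv_coef hP hV]
    exact N.smul_mem _ (hN _ (h _ _))
  · rw [FiberData.coef_smul_right, T.coef_comp_φ hP hV]
    exact N.smul_mem _ (h _ _)

/-! ### The differential Hopf algebra of matrix coefficients -/

/-- The differential Hopf algebra of matrix coefficients. -/
def coefHopf {P : ObjectProperty C} (hP : T.IsDiffTensorClosed P) :
    DiffHopfStructure k (T.CoefSpace P) where
  toCoalgebra := T.coefCoalgebra P
  mul := T.coefMul hP
  one := T.coefOne hP
  mul_assoc := T.coefMul_assoc hP
  mul_comm := T.coefMul_comm hP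
  one_mul := T.one_coefMul hP
  comul_one := T.coefComul_one hP
  comul_mul := T.coefComul_mul hP
  counit_one := T.coefCounit_one hP
  counit_mul := T.coefCounit_mul hP
  antipode := T.coefAntipode hP
  antipode_one := T.coefAntipode_one hP
  antipode_mul := T.coefAntipode_mul hP
  mul_antipode_left := T.mul_coefAntipode_left hP
  mul_antipode_right := T.mul_coefAntipode_right hP
  deriv := T.coefDeriv hP
  deriv_smul := T.coefDeriv_smul hP
  deriv_mul := T.coefDeriv_mul hP
  comul_deriv := T.coefComul_deriv hP
  counit_deriv := T.coefCounit_deriv hP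
  antipode_deriv := T.coefAntipode_deriv hP

theorem hasOperations_coefHopf {P : ObjectProperty C} (hP : T.IsDiffTensorClosed P) :
    T.HasOperations hP (T.coefHopf hP) where
  one := rfl
  mul := T.coefMul_coef hP
  comul hV v u _ b := T.coefComul_coef_basis P hV v u b
  counit := T.coefCounit_coef P
  antipode := T.coefAntipode_coef hP
  deriv := T.coefDeriv_coef hP

theorem isHom_coefMap {P Q : ObjectProperty C} (hP : T.IsDiffTensorClosed P)
    (hQ : T.IsDiffTensorClosed Q) (h : P ≤ Q) :
    (T.coefHopf hP).IsHom (T.coefHopf hQ) (T.coefMap h) where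
  map_one := T.coefMap_coef h _ _ _ _
  map_mul a b := by
    change T.coefMap h (T.coefMul hP a b) = T.coefMul hQ (T.coefMap h a) (T.coefMap h b)
    induction a using T.coef_induction with
    | zero => simp
    | add a a' ha hb => simp only [map_add, LinearMap.add_apply, ha, hb]
    | coef V hV v u =>
    induction b using T.coef_induction with
    | zero => simp
    | add a a' ha hb => simp only [map_add, ha, hb]
    | coef W hW w t => simp only [T.coefMul_coef, T.coefMap_coef]
  map_comul a := by
    change T.coefComul Q (T.coefMap h a) = TensorProduct.map _ _ (T.coefComul P a)
    induction a using T.coef_induction with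
    | zero => simp
    | add a a' ha hb => simp only [map_add, ha, hb]
    | coef V hV v u =>
    rw [T.coefMap_coef, T.coefComul_coef_basis Q _ _ _ (Module.finBasis k (T.ω.obj V)),
      T.coefComul_coef_basis P _ _ _ (Module.finBasis k (T.ω.obj V))]
    simp only [map_sum, TensorProduct.map_tmul, T.coefMap_coef]
  map_counit a := by
    change T.coefCounit Q (T.coefMap h a) = T.coefCounit P a
    induction a using T.coef_induction with
    | zero => simp
    | add a a' ha hb => simp only [map_add, ha, hb]
    | coef V hV v u => rw [T.coefMap_coef, T.coefCounit_coef, T.coefCounit_coef]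
  map_antipode a := by
    change T.coefMap h (T.coefAntipode hP a) = T.coefAntipode hQ (T.coefMap h a)
    induction a using T.coef_induction with
    | zero => simp
    | add a a' ha hb => simp only [map_add, ha, hb]
    | coef V hV v u =>
    obtain ⟨ξ, rfl⟩ := (T.toDual_bijective V).2 u
    rw [T.coefAntipode_coef, T.coefMap_coef, T.coefMap_coef, T.coefAntipode_coef]
  map_deriv a := by
    change T.coefMap h (T.coefDeriv hP a) = T.coefDeriv hQ (T.coefMap h a)
    induction a using T.coef_induction with
    | zero => simp
    | add a a' ha hb => simp only [map_add, ha, hb]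
    | coef V hV v u => rw [coefDeriv_coef, T.coefMap_coef, T.coefMap_coef, coefDeriv_coef]

variable {T} in
/-- A subspace of `B_X` that is closed under all operations and contains the matrix coefficients of
`X` contains all matrix coefficients. -/
theorem coef_mem_of_diffGen {X : C} (N : Submodule k (T.BX X))
    (hone : T.coefOne (T.isDiffTensorClosed_diffGen X) ∈ N)
    (hmul : ∀ a ∈ N, ∀ b ∈ N, T.coefMul (T.isDiffTensorClosed_diffGen X) a b ∈ N)
    (hder : ∀ a ∈ N, T.coefDeriv (T.isDiffTensorClosed_diffGen X) a ∈ N)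
    (hant : ∀ a ∈ N, T.coefAntipode (T.isDiffTensorClosed_diffGen X) a ∈ N)
    (hX : ∀ v u, T.coef (P := T.diffGen X) X .self v u ∈ N) {Y : C} (hY : T.diffGen X Y)
    (v : T.ω.obj Y) (u : Module.Dual k (T.ω.obj Y)) : T.coef Y hY v u ∈ N := by
  have hP := T.isDiffTensorClosed_diffGen X
  induction hY with
  | self => exact hX v u
  | unit => exact FiberData.coef_mem_of_unit N hP hone v u
  | biprod h₁ h₂ ih₁ ih₂ => exact FiberData.coef_mem_of_biprod N h₁ h₂ _ ih₁ ih₂ v u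
  | sub f h ih => exact FiberData.coef_mem_of_mono N _ h f ih v u
  | quot f h ih => exact FiberData.coef_mem_of_epi N h _ f ih v u
  | tensor h₁ h₂ ih₁ ih₂ => exact FiberData.coef_mem_of_tensor N h₁ h₂ hP hmul ih₁ ih₂ v u
  | dual h ih => exact FiberData.coef_mem_of_dual N h hP hant ih v u
  | prolong h ih => exact coef_mem_of_prolong N h hP hder ih v u

-- The matrix entries of `X` in one basis generate `B_X` under product, derivation and coinverse;
-- the involutivity of the coinverse then removes it from the list of operations.
open scoped Classical in
theorem isFinDiffGenerated_diffGen (X : C) :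
    (T.coefHopf (T.isDiffTensorClosed_diffGen X)).IsFinDiffGenerated := by
  let b := Module.finBasis k (T.ω.obj X)
  let c : Fin _ × Fin _ → T.BX X := fun p => T.coef X .self (b p.1) (b.coord p.2)
  refine (T.coefHopf (T.isDiffTensorClosed_diffGen X)).isFinDiffGenerated_of_generates
    (T.coefAntipode_antipode (T.isDiffTensorClosed_diffGen X))
    (Finset.univ.image c) fun N hone hmul hder hant hG => ?_
  have hc : ∀ p, c p ∈ N := fun p => hG _ (Finset.mem_image_of_mem c (Finset.mem_univ p))
  refine eq_top_iff.2 fun a _ => ?_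
  induction a using T.coef_induction with
  | zero => exact N.zero_mem
  | add a a' ha hb => exact N.add_mem (ha trivial) (hb trivial)
  | coef V hV v u =>
    exact coef_mem_of_diffGen N hone hmul hder hant
      (FiberData.coef_mem_of_basis N _ b fun i j => hc (i, j)) hV v u

end NeutralDiffTannakian

end

end DiffTannakian

/-! ### The main theorem -/

open DiffTannakian in
theorem proposition3p12 {k : Type u} [Field k] [CharZero k] [Differential k]
    {C : Type u₁} [Category.{v₁} C] [Abelian C] [MonoidalCategory C] [SymmetricCategory C]
    [RigidCategory C] [MonoidalPreadditive C] [Linear k C] [MonoidalLinear k C]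
    (T : NeutralDiffTannakian k C) :
    ∃ (HA : DiffHopfStructure k T.A) (HB : ∀ X : C, DiffHopfStructure k (T.BX X)),
      T.HasOperations T.isDiffTensorClosed_top HA ∧
      (∀ X, T.HasOperations (T.isDiffTensorClosed_diffGen X) (HB X)) ∧
      (∀ X, (HB X).IsFinDiffGenerated) ∧
      (∀ (X Y : C) (h : T.diffGen X ≤ T.diffGen Y), (HB X).IsHom (HB Y) (T.coefMap h)) ∧
      (∀ X, (HB X).IsHom HA (T.coefMap le_top)) ∧
      IsDirectLimit (ι := T.DiffIndex) (fun X => T.BX X.obj) (fun _ _ h => T.coefMap h)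
        T.A (fun _ => T.coefMap le_top) ∧
      ∀ X : C, IsDirectLimit (ι := T.AbIndex X) (fun Y => T.AX Y.1) (fun _ _ h => T.coefMap h)
        (T.BX X) (fun Y => T.coefMap (T.abGen_le_diffGen Y.2)) :=
  ⟨T.coefHopf T.isDiffTensorClosed_top, fun X => T.coefHopf (T.isDiffTensorClosed_diffGen X),
    T.hasOperations_coefHopf _, fun _ => T.hasOperations_coefHopf _,
    T.isFinDiffGenerated_diffGen, fun _ _ h => T.isHom_coefMap _ _ h,
    fun _ => T.isHom_coefMap _ _ le_top,
    T.isDirectLimit_coefSpace (ι := T.DiffIndex) (fun X => T.diffGen X.obj) (fun _ _ h => h) ⊤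
      (fun _ => le_top) fun V _ => ⟨⟨V⟩, .self⟩,
    fun X => T.isDirectLimit_coefSpace (ι := T.AbIndex X) (fun Y => FiberData.abGen Y.1)
      (fun _ _ h => h) (T.diffGen X) (fun Y => T.abGen_le_diffGen Y.2)
      fun V hV => ⟨⟨V, hV⟩, .self⟩⟩
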